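/- **Notation.** All variables are integers. A representation $(u,v)$ is *proper* if $\gcd(u,v)=1$ and *improper* otherwise. For $n\ge 1$ let $P_r(n)$ be the number of distinct primes $p\mid n$ with $p\equiv r \pmod 8$. A *primitive triple with $q<c_3$* consists of integers $0<c_1<c_2<c_3$ with $\gcd(c_1,c_2,c_3)=1$ such that $q=\sqrt{c_1c_2+c_1c_3+c_2c_3}$ is an integer and $q<c_3$. To it belong $k=c_3-q$, $X=c_2-c_1$, $\widehat Y=c_1+c_2+k$, $t=2q-c_1-c_2$; such a quadruple $(X,\widehat Y,t,k)$ is called a *final solution*. The *family* of a solution $(X,\widehat Y)$ of $X^2-2\widehat Y^2=-a$ with $\widehat Y>0$ consists of its images under all integer powers of $(X,\widehat Y)\mapsto(3X+4\widehat Y,\,2X+3\widehat Y)$; the *conjugate family* arises by $X\mapsto -X$. Say that $n$ is *of the form* $(*)$ if $n=2^{e_2}\prod_i p_i^{e_i}$ with $e_2\in\{0,1\}$, $e_i\ge0$ and distinct primes $p_i\equiv1\pmod 8$. **Proposition.** 0. Every final solution satisfies $X^2-2\widehat Y^2=-a$ and $t^2+2k^2=a$ for some $a>2$, with $t,k>0$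 and $0<X<\widehat Y-k$ (so $X<\widehat Y$). Moreover $\gcd(X,\widehat Y)$ and $\gcd(t,k)$ are coprime for every final solution. Let $a\ge2$. If $X^2-2\widehat Y^2=-a$, $t^2+2k^2=a$, $0<X<\widehat Y$, $t>0$, $k>0$, and the two representations are not both improper, then they are of one of the following three types. (a) Both representations are proper, and $a$ is of the form $(*)$. For $a\ge2$, both forms have proper representations (of $-a$ and $a$, respectively, without sign conditions) if and only if $a$ is of the form $(*)$. If moreover $a>2$, each pair of conjugate families of proper solutions of $X^2-2\widehat Y^2=-a$ contains exactly one solution with $0<X<\widehat Y$. (b) $(X,\widehat Y)$ is improper, $(t,k)$ is proper, and with $A=\gcd(X,\widehat Y)$ one has $$a=A^2\tilde a,\qquad A\ge2,\qquad \tilde a>2,$$ where $A$ is a product of primes $\equiv1,3\pmod8$ and $\tilde a$ is of the form $(*)$. Conversely, for $a,A\ge2$ there are solutions with $0<X<\widehat Y$, $\gcd(X,\widehat Y)=A$ and $t,k>0$, $\gcd(t,k)=1$ if and only if such an $\tilde a$ exists. In this case: the primes $\equiv1\pmod8$ dividing $a$ are those dividing $A$ or $\tilde a$, the primes $\equiv3\pmod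 8$ dividing $a$ are those dividing $A$, and $P_1(A)+P_3(A)>0$; the solutions with $\gcd(X,\widehat Y)=A$ are exactly $X=A\tilde X$, $\widehat Y=A\tilde{\widehat Y}$ with $(\tilde X,\tilde{\widehat Y})$ a proper solution of $\tilde X^2-2\tilde{\widehat Y}{}^2=-\tilde a$; each pair of conjugate families of proper solutions of the latter contains exactly one with $0<\tilde X<\tilde{\widehat Y}$; and $t^2+2k^2=a$ has exactly $2^{P_1(a)+P_3(a)-1}$ proper solutions with $t,k>0$. (c) $(X,\widehat Y)$ is proper, $(t,k)$ is improper, and with $A=\gcd(t,k)$ one has $$a=A^2\tilde a,\qquad A\ge2,\qquad \tilde a>2,$$ where $A$ is a product of primes $\equiv1,7\pmod8$ and $\tilde a$ is of the form $(*)$. Conversely, for $a,A\ge2$ there are solutions with $0<X<\widehat Y$, $\gcd(X,\widehat Y)=1$ and $t,k>0$, $\gcd(t,k)=A$ if and only if such an $\tilde a$ exists. In this case: the primes $\equiv1\pmod8$ dividing $a$ are those dividing $A$ or $\tilde a$, the primes $\equiv7\pmod 8$ dividing $a$ are those dividing $A$, and $P_1(A)+P_7(A)>0$; the solutions with $\gcd(t,k)=A$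 are exactly $t=A\tilde t$, $k=A\tilde k$ with $(\tilde t,\tilde k)$ a proper solution of $\tilde t^2+2\tilde k^2=\tilde a$; there are exactly $2^{P_1(\tilde a)-1}$ of these with $\tilde t,\tilde k>0$; each pair of conjugate families of proper solutions of $X^2-2\widehat Y^2=-a$ contains exactly one solution with $0<X<\widehat Y$; and there are in total exactly $2^{P_1(a)+P_7(a)-1}$ proper solutions with $0<X<\widehat Y$. The smallest $a$ for which a final solution of the respective type exists is $89$ for (a) (triple $[1,4,9]$, $q=7$), $153$ for (b) (triple $[1,4,12]$, $q=8$), and $1666=7^2\cdot 34$ for (c) (triple $[2,6,39]$, $q=18$). -/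

import Mathlib

/-- The indefinite form: `(X, Y)` represents `-a` by `X² - 2Y²`. -/
def IndefRep (a : ℕ) (X Y : ℤ) : Prop := X ^ 2 - 2 * Y ^ 2 = -(a : ℤ)

/-- The definite form: `(t, k)` represents `a` by `t² + 2k²`. -/
def DefRep (a : ℕ) (t k : ℤ) : Prop := t ^ 2 + 2 * k ^ 2 = (a : ℤ)

/-- A simultaneous representation satisfying the necessary conditions
`0 < X < Y` (where `Y` plays the role of `Ŷ`), `0 < t`, `0 < k`. -/
structure Qualifies (a : ℕ) (X Y t k : ℤ) : Prop where
  indef : IndefRep a X Y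
  defin : DefRep a t k
  X_pos : 0 < X
  X_lt : X < Y
  t_pos : 0 < t
  k_pos : 0 < k

/-- `[c₁, c₂, c₃]` is a primitive Descartes-Steiner triple with distinct entries and with
`q = √(c₁c₂ + c₁c₃ + c₂c₃) < c₃` (as `q²` is an integer, `c₁ + c₂ + c₃ ± 2q` are integers exactly
when `q` is), and `(X, Y)`, `(t, k)` are the arguments of the two forms that belong to it. -/
structure TripleData (c₁ c₂ c₃ q X Y t k : ℤ) : Prop where
  pos : 0 < c₁
  lt₁₂ : c₁ < c₂
  lt₂₃ : c₂ < c₃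
  primitive : Int.gcd (Int.gcd c₁ c₂) c₃ = 1
  q_pos : 0 < q
  q_sq : q ^ 2 = c₁ * c₂ + c₁ * c₃ + c₂ * c₃
  q_lt : q < c₃
  k_eq : k = c₃ - q
  X_eq : X = c₂ - c₁
  Y_eq : Y = c₁ + c₂ + k
  t_eq : t = 2 * q - (c₁ + c₂)

/-- `(X, Y)`, `(t, k)` is a final solution: it comes from a primitive triple with `q < c₃`. -/
def IsFinal (X Y t k : ℤ) : Prop := ∃ c₁ c₂ c₃ q : ℤ, TripleData c₁ c₂ c₃ q X Y t k

/-- `m` is a product of powers of distinct primes whose residues modulo `8` lie in `R`. -/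
def IsPrimeProd (R : Set ℕ) (m : ℕ) : Prop :=
  ∃ (S : Finset ℕ) (e : ℕ → ℕ), (∀ p ∈ S, p.Prime ∧ p % 8 ∈ R) ∧ m = ∏ p ∈ S, p ^ e p

/-- `n = 2^e₂ ∏ pᵢ^eᵢ` with `e₂ ∈ {0, 1}` and distinct primes `pᵢ ≡ 1 (mod 8)`. -/
def IsTwoPrimeProd (n : ℕ) : Prop :=
  ∃ e₂ m : ℕ, (e₂ = 0 ∨ e₂ = 1) ∧ IsPrimeProd {1} m ∧ n = 2 ^ e₂ * m

/-- The decomposition `a = A² b` with `A ≥ 2` a product of primes with residues in `R` modulo `8`,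
and `b > 2` a product of primes `≡ 1 (mod 8)`, possibly times `2` (`b` plays the role of `ã`). -/
structure IsDecomp (R : Set ℕ) (a A b : ℕ) : Prop where
  two_le : 2 ≤ A
  eq : a = A ^ 2 * b
  primes_A : IsPrimeProd R A
  primes_b : IsTwoPrimeProd b
  two_lt : 2 < b

/-- The distinct prime divisors of `n` that are congruent to `r` modulo `8`. -/
def primesMod (r n : ℕ) : Finset ℕ := n.primeFactors.filter (fun p => p % 8 = r)

/-- The automorphism `(X, Y) ↦ (3X + 4Y, 2X + 3Y)` of `X² - 2Y²`. -/
def auto : Equiv.Perm (ℤ × ℤ) where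
  toFun v := (3 * v.1 + 4 * v.2, 2 * v.1 + 3 * v.2)
  invFun v := (3 * v.1 - 4 * v.2, -2 * v.1 + 3 * v.2)
  left_inv v := by ext <;> simp <;> ring
  right_inv v := by ext <;> simp <;> ring

/-- The family of a solution: all its images under integer powers of the automorphism. -/
def family (v : ℤ × ℤ) : Set (ℤ × ℤ) := {w | ∃ n : ℤ, w = (auto ^ n) v}

/-- The conjugate family, obtained by `X ↦ -X`. -/
def conjFamily (v : ℤ × ℤ) : Set (ℤ × ℤ) := {w | (-w.1, w.2) ∈ family v}

/-- Each pair of conjugate families of proper solutions of `X² - 2Y² = -a` (normalized by `0 < Y`)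
contains exactly one solution with `0 < X < Y`. -/
def OnePerConjugatePair (a : ℕ) : Prop :=
  ∀ v : ℤ × ℤ, IndefRep a v.1 v.2 → Int.gcd v.1 v.2 = 1 → 0 < v.2 →
    ∃! w : ℤ × ℤ, w ∈ family v ∪ conjFamily v ∧ 0 < w.1 ∧ w.1 < w.2

/-- The proper solutions of `X² - 2Y² = -a` with `0 < X < Y`. -/
def properIndef (a : ℕ) : Set (ℤ × ℤ) :=
  {v | IndefRep a v.1 v.2 ∧ Int.gcd v.1 v.2 = 1 ∧ 0 < v.1 ∧ v.1 < v.2}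

/-- The proper solutions of `t² + 2k² = a` with `0 < t` and `0 < k`. -/
def properDef (a : ℕ) : Set (ℤ × ℤ) :=
  {v | DefRep a v.1 v.2 ∧ Int.gcd v.1 v.2 = 1 ∧ 0 < v.1 ∧ 0 < v.2}

/-! In a proper representation of `±n` by `x ^ 2 - d * y ^ 2` the number `y` is invertible modulo
`n`, so `x / y` is a square root `z` of `d` modulo `n`; the representation belongs to the root `z`.
For `n > 2` each root owns exactly one proper representation: for `d = -2` one of `n` with `0 < y`,
for `d = 2` one of `-n` with `|x| < y`. Existence is Thue's pigeonhole argument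
(`exists_small_modEq`), followed for `d = 2` by a descent inside the family (`exists_reduced`).
Uniqueness holds because two representations of the same root differ by a unit of norm 1 in `ℤ[√d]`,
and the normalization leaves only the unit 1.

Since `x ↦ -x` permutes these representations without fixed points, those with `0 < x` number half
the roots (`two_mul_ncard_eq_sqrtCount`). The Chinese remainder theorem and Hensel lifting give one
factor 2 per odd prime divisor, provided `4 ∤ n` and `d` is a nonzero square modulo these primes.

By the supplementary laws, `2` is a square modulo odd `p` iff `p ≡ 1, 7`, and `-2` iff `p ≡ 1, 3
(mod 8)`. Two proper representations leave only `p ≡ 1`. If one of them has gcd `A`, the primes of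
`A` obey just the law of the proper form, while the cofactor obeys both laws; this gives types (b)
and (c).

For triples, eliminating `c₃` and `q` yields an identity for `t ^ 2` (`TripleData.t_sq`), which
implies the equality of the two forms and reduces the minimality claims to short finite searches. -/

/-! ### Products of primes in given residue classes -/

theorem isPrimeProd_iff {R : Set ℕ} {m : ℕ} :
    IsPrimeProd R m ↔ m ≠ 0 ∧ ∀ p : ℕ, p.Prime → p ∣ m → p % 8 ∈ R := by
  constructor
  · rintro ⟨S, e, hS, rfl⟩
    refine ⟨Finset.prod_ne_zero_iff.2 fun p hp => pow_ne_zero _ (hS p hp).1.ne_zero, ?_⟩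
    intro p hp hdvd
    obtain ⟨q, hq, hpq⟩ := (hp.prime.dvd_finsetProd_iff _).1 hdvd
    have := (Nat.prime_dvd_prime_iff_eq hp (hS q hq).1).1 (hp.dvd_of_dvd_pow hpq)
    exact this ▸ (hS q hq).2
  · rintro ⟨h0, h⟩
    refine ⟨m.primeFactors, m.factorization, fun p hp => ?_, ?_⟩
    · have hp' := Nat.prime_of_mem_primeFactors hp
      exact ⟨hp', h p hp' (Nat.dvd_of_mem_primeFactors hp)⟩
    · exact (Nat.prod_factorization_pow_eq_self h0).symm

theorem IsPrimeProd.odd {R : Set ℕ} {m : ℕ} (h : IsPrimeProd R m) (hR : 2 ∉ R) : ¬ 2 ∣ m :=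
  fun h2 => hR ((isPrimeProd_iff.1 h).2 2 Nat.prime_two h2)

theorem isTwoPrimeProd_iff {n : ℕ} :
    IsTwoPrimeProd n ↔
      n ≠ 0 ∧ ¬ 4 ∣ n ∧ ∀ p : ℕ, p.Prime → p ∣ n → p ≠ 2 → p % 8 = 1 := by
  constructor
  · rintro ⟨e, m, he, hm, rfl⟩
    have hodd := hm.odd (by simp)
    obtain ⟨h0, h⟩ := isPrimeProd_iff.1 hm
    refine ⟨by positivity, by rcases he with rfl | rfl <;> omega, fun p hp hdvd hp2 => ?_⟩
    rcases hp.dvd_mul.1 hdvd with h' | h'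
    · exact absurd ((Nat.prime_dvd_prime_iff_eq hp Nat.prime_two).1 (hp.dvd_of_dvd_pow h')) hp2
    · simpa using h p hp h'
  · rintro ⟨h0, h4, h⟩
    by_cases h2 : 2 ∣ n
    · obtain ⟨m, rfl⟩ := h2
      refine ⟨1, m, Or.inr rfl, isPrimeProd_iff.2 ⟨by omega, fun p hp hdvd => ?_⟩, by ring⟩
      refine h p hp (hdvd.mul_left 2) ?_
      rintro rfl
      omega
    · refine ⟨0, n, Or.inl rfl, isPrimeProd_iff.2 ⟨h0, fun p hp hdvd => ?_⟩, by ring⟩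
      refine h p hp hdvd ?_
      rintro rfl
      exact h2 hdvd

/-! ### Counting square roots modulo `n` -/

/-- The number of square roots of `d` modulo `n`. -/
noncomputable def sqrtCount (d : ℤ) (n : ℕ) : ℕ := Nat.card {z : ZMod n // z ^ 2 = (d : ZMod n)}

theorem sqrtCount_mul (d : ℤ) {m n : ℕ} (h : m.Coprime n) :
    sqrtCount d (m * n) = sqrtCount d m * sqrtCount d n := by
  unfold sqrtCount
  rw [← Nat.card_prod]
  refine Nat.card_congr (Equiv.trans ?_ (Equiv.subtypeProdEquivProd
    (p := fun z : ZMod m => z ^ 2 = (d : ZMod m)) (q := fun z : ZMod n => z ^ 2 = (d : ZMod n))))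
  refine (ZMod.chineseRemainder h).toEquiv.subtypeEquiv fun z => ?_
  have hd : ZMod.chineseRemainder h (d : ZMod (m * n)) = ((d : ZMod m), (d : ZMod n)) := by
    rw [map_intCast]; rfl
  rw [← (ZMod.chineseRemainder h).injective.eq_iff, hd, map_pow, Prod.ext_iff]
  rfl

theorem sqrtCount_one (d : ℤ) : sqrtCount d 1 = 1 := by
  unfold sqrtCount
  have : Unique {z : ZMod 1 // z ^ 2 = (d : ZMod 1)} :=
    { default := ⟨0, Subsingleton.elim _ _⟩
      uniq := fun z => Subtype.ext (Subsingleton.elim _ _) }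
  exact Nat.card_unique

theorem sqrtCount_two (d : ℤ) : sqrtCount d 2 = 1 := by
  unfold sqrtCount
  have h : ∀ z : ZMod 2, z ^ 2 = z := by decide
  have : Unique {z : ZMod 2 // z ^ 2 = (d : ZMod 2)} :=
    { default := ⟨d, h _⟩
      uniq := fun z => Subtype.ext (by rw [← h z.1, z.2]) }
  exact Nat.card_unique

/-- Hensel lifting: the derivative `2 * z` is a unit modulo `p`. -/
theorem exists_sq_modEq_prime_pow {p : ℕ} (hp : p.Prime) (hp2 : p ≠ 2) {d : ℤ}
    (hd : ¬ (p : ℤ) ∣ d) (hsq : ∃ z : ℤ, (p : ℤ) ∣ z ^ 2 - d) (k : ℕ) :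
    ∃ z : ℤ, (p : ℤ) ^ (k + 1) ∣ z ^ 2 - d := by
  have hpp : Prime (p : ℤ) := Nat.prime_iff_prime_int.1 hp
  induction k with
  | zero => simpa using hsq
  | succ k ih =>
    obtain ⟨z, c, hc⟩ := ih
    have hz : ¬ (p : ℤ) ∣ 2 * z := by
      intro h
      rcases hpp.dvd_or_dvd h with h | h
      · have h2 : p ∣ 2 := by exact_mod_cast h
        exact hp2 ((Nat.prime_dvd_prime_iff_eq hp Nat.prime_two).1 h2)
      · refine hd ?_
        have h1 : (p : ℤ) ∣ z ^ 2 - d := hc ▸ (dvd_pow_self _ (Nat.succ_ne_zero k)).mul_right c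
        exact (dvd_sub_right (dvd_pow h two_ne_zero)).1 h1
    obtain ⟨r, s, hrs⟩ := (hpp.coprime_iff_not_dvd).2 hz
    -- Newton step: `s` inverts `2 * z` modulo `p`, and `c` is the current error divided by `p ^ (k
    -- + 1)`.
    refine ⟨z - (p : ℤ) ^ (k + 1) * (s * c), r * c + (p : ℤ) ^ k * (s * c) ^ 2, ?_⟩
    linear_combination hc - (p : ℤ) ^ (k + 1) * c * hrs

/-- The roots are `±r`: as `p ∤ 2 * r`, it cannot divide both `x - r` and `x + r`, so the full prime
power divides one of them. -/
theorem sqrtCount_prime_pow {p : ℕ} (hp : p.Prime) (hp2 : p ≠ 2) {d : ℤ}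
    (hd : ¬ (p : ℤ) ∣ d) (hsq : ∃ z : ℤ, (p : ℤ) ∣ z ^ 2 - d) {k : ℕ} (hk : 0 < k) :
    sqrtCount d (p ^ k) = 2 := by
  have hpp : Prime (p : ℤ) := Nat.prime_iff_prime_int.1 hp
  obtain ⟨k, rfl⟩ : ∃ j, k = j + 1 := ⟨k - 1, by omega⟩
  obtain ⟨r, hr⟩ := exists_sq_modEq_prime_pow hp hp2 hd hsq k
  have hr2 : ¬ (p : ℤ) ∣ 2 * r := by
    intro h
    rcases hpp.dvd_or_dvd h with h | h
    · have h2 : p ∣ 2 := by exact_mod_cast h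
      exact hp2 ((Nat.prime_dvd_prime_iff_eq hp Nat.prime_two).1 h2)
    · refine hd ?_
      have h1 : (p : ℤ) ∣ r ^ 2 - d := (dvd_pow_self _ (Nat.succ_ne_zero k)).trans hr
      exact (dvd_sub_right (dvd_pow h two_ne_zero)).1 h1
  have hcast : ∀ x : ℤ, ((x : ZMod (p ^ (k + 1))) = 0) ↔ (p : ℤ) ^ (k + 1) ∣ x := fun x => by
    rw [ZMod.intCast_zmod_eq_zero_iff_dvd]; push_cast; rfl
  have hset : {z : ZMod (p ^ (k + 1)) | z ^ 2 = (d : ZMod (p ^ (k + 1)))} =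
      {(r : ZMod (p ^ (k + 1))), -(r : ZMod (p ^ (k + 1)))} := by
    ext z
    obtain ⟨x, rfl⟩ := ZMod.intCast_surjective z
    have e1 : ((x : ZMod (p ^ (k + 1))) ^ 2 = d) ↔ (p : ℤ) ^ (k + 1) ∣ x ^ 2 - d := by
      rw [← hcast, ← sub_eq_zero]; push_cast; rfl
    have e2 : ((x : ZMod (p ^ (k + 1))) = r) ↔ (p : ℤ) ^ (k + 1) ∣ x - r := by
      rw [← hcast, ← sub_eq_zero]; push_cast; rfl
    have e3 : ((x : ZMod (p ^ (k + 1))) = -r) ↔ (p : ℤ) ^ (k + 1) ∣ x + r := by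
      rw [← hcast, ← sub_eq_zero, sub_neg_eq_add]; push_cast; rfl
    simp only [Set.mem_ofPred_eq, Set.mem_insert_iff, Set.mem_singleton_iff, e1, e2, e3]
    constructor
    · intro h
      have h' : (p : ℤ) ^ (k + 1) ∣ (x - r) * (x + r) := by
        have := dvd_sub h hr
        rwa [show x ^ 2 - d - (r ^ 2 - d) = (x - r) * (x + r) by ring] at this
      by_cases hx : (p : ℤ) ∣ x - r
      · left
        have hx' : ¬ (p : ℤ) ∣ x + r := fun h2 => hr2 (by
          have := dvd_sub h2 hx
          rwa [show x + r - (x - r) = 2 * r by ring] at this)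
        exact IsCoprime.dvd_of_dvd_mul_right
          (IsCoprime.pow_left ((hpp.coprime_iff_not_dvd).2 hx')) h'
      · right
        exact IsCoprime.dvd_of_dvd_mul_left
          (IsCoprime.pow_left ((hpp.coprime_iff_not_dvd).2 hx)) h'
    · rintro (h | h)
      · have := (h.mul_right (x + r)).add hr
        rwa [show (x - r) * (x + r) + (r ^ 2 - d) = x ^ 2 - d by ring] at this
      · have := (h.mul_right (x - r)).add hr
        rwa [show (x + r) * (x - r) + (r ^ 2 - d) = x ^ 2 - d by ring] at this
  have hne : (r : ZMod (p ^ (k + 1))) ≠ -(r : ZMod (p ^ (k + 1))) := by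
    intro h
    refine hr2 ((dvd_pow_self (p : ℤ) (Nat.succ_ne_zero k)).trans ((hcast _).1 ?_))
    push_cast
    linear_combination h
  calc sqrtCount d (p ^ (k + 1))
      = Set.ncard {z : ZMod (p ^ (k + 1)) | z ^ 2 = (d : ZMod (p ^ (k + 1)))} := rfl
    _ = 2 := by rw [hset, Set.ncard_pair hne]

theorem sqrtCount_odd {d : ℤ} (n : ℕ) (hn : n ≠ 0) (hodd : ¬ 2 ∣ n)
    (h : ∀ p : ℕ, p.Prime → p ∣ n → ¬ (p : ℤ) ∣ d ∧ ∃ z : ℤ, (p : ℤ) ∣ z ^ 2 - d) :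
    sqrtCount d n = 2 ^ n.primeFactors.card := by
  induction n using Nat.recOnPosPrimePosCoprime with
  | zero => exact absurd rfl hn
  | one => simp [sqrtCount_one]
  | prime_pow p k hp hk =>
    have hpd : p ∣ p ^ k := dvd_pow_self p hk.ne'
    rw [sqrtCount_prime_pow hp (by rintro rfl; exact hodd hpd) (h p hp hpd).1 (h p hp hpd).2 hk,
      Nat.primeFactors_prime_pow hk.ne' hp]
    simp
  | coprime a b ha hb hab iha ihb =>
    rw [sqrtCount_mul d hab, hab.primeFactors_mul,
      Finset.card_union_of_disjoint hab.disjoint_primeFactors, pow_add,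
      iha (by omega) (fun h2 => hodd (h2.mul_right b)) fun p hp hd => h p hp (hd.mul_right b),
      ihb (by omega) (fun h2 => hodd (h2.mul_left a)) fun p hp hd => h p hp (hd.mul_left a)]

/-- Modulo `2` there is a single root, so a simple factor `2` does not change the count. -/
theorem sqrtCount_eq {d : ℤ} {n : ℕ} (hn : n ≠ 0) (h4 : ¬ 4 ∣ n)
    (h : ∀ p : ℕ, p.Prime → p ∣ n → p ≠ 2 → ¬ (p : ℤ) ∣ d ∧ ∃ z : ℤ, (p : ℤ) ∣ z ^ 2 - d) :
    sqrtCount d n = 2 ^ (n.primeFactors.erase 2).card := by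
  by_cases h2 : 2 ∣ n
  · obtain ⟨m, rfl⟩ := h2
    have hm : ¬ 2 ∣ m := by omega
    have hc : Nat.Coprime 2 m := (Nat.Prime.coprime_iff_not_dvd Nat.prime_two).2 hm
    have he : (2 * m).primeFactors.erase 2 = m.primeFactors := by
      rw [hc.primeFactors_mul, Nat.Prime.primeFactors Nat.prime_two, ← Finset.insert_eq,
        Finset.erase_insert (fun h => hm (Nat.dvd_of_mem_primeFactors h))]
    rw [sqrtCount_mul d hc, sqrtCount_two, one_mul, he]
    exact sqrtCount_odd m (by omega) hm fun p hp hd =>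
      h p hp (hd.mul_left 2) (by rintro rfl; exact hm hd)
  · rw [Finset.erase_eq_of_notMem (fun h => h2 (Nat.dvd_of_mem_primeFactors h))]
    exact sqrtCount_odd n hn h2 fun p hp hd => h p hp hd (by rintro rfl; exact h2 hd)

theorem exists_sq_sub_two_iff {p : ℕ} (hp : p.Prime) (hp2 : p ≠ 2) :
    (∃ z : ℤ, (p : ℤ) ∣ z ^ 2 - 2) ↔ p % 8 = 1 ∨ p % 8 = 7 := by
  have := Fact.mk hp
  rw [← ZMod.exists_sq_eq_two_iff hp2]
  constructor
  · rintro ⟨z, hz⟩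
    refine ⟨z, ?_⟩
    have := (ZMod.intCast_zmod_eq_zero_iff_dvd _ p).2 hz
    push_cast at this
    linear_combination -this
  · rintro ⟨z, hz⟩
    obtain ⟨x, rfl⟩ := ZMod.intCast_surjective z
    refine ⟨x, (ZMod.intCast_zmod_eq_zero_iff_dvd _ p).1 ?_⟩
    push_cast
    linear_combination -hz

theorem exists_sq_add_two_iff {p : ℕ} (hp : p.Prime) (hp2 : p ≠ 2) :
    (∃ z : ℤ, (p : ℤ) ∣ z ^ 2 - -2) ↔ p % 8 = 1 ∨ p % 8 = 3 := by
  have := Fact.mk hp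
  rw [← ZMod.exists_sq_eq_neg_two_iff hp2]
  constructor
  · rintro ⟨z, hz⟩
    refine ⟨z, ?_⟩
    have := (ZMod.intCast_zmod_eq_zero_iff_dvd _ p).2 hz
    push_cast at this
    linear_combination -this
  · rintro ⟨z, hz⟩
    obtain ⟨x, rfl⟩ := ZMod.intCast_surjective z
    refine ⟨x, (ZMod.intCast_zmod_eq_zero_iff_dvd _ p).1 ?_⟩
    push_cast
    linear_combination -hz

theorem not_dvd_two {p : ℕ} (hp : p.Prime) (hp2 : p ≠ 2) : ¬ (p : ℤ) ∣ 2 := fun h =>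
  hp2 ((Nat.prime_dvd_prime_iff_eq hp Nat.prime_two).1 (by exact_mod_cast h))

theorem sqrtCount_two_eq {n : ℕ} (hn : n ≠ 0) (h4 : ¬ 4 ∣ n)
    (h : ∀ p : ℕ, p.Prime → p ∣ n → p ≠ 2 → p % 8 = 1 ∨ p % 8 = 7) :
    sqrtCount 2 n = 2 ^ (n.primeFactors.erase 2).card :=
  sqrtCount_eq hn h4 fun p hp hd hp2 =>
    ⟨not_dvd_two hp hp2, (exists_sq_sub_two_iff hp hp2).2 (h p hp hd hp2)⟩

theorem sqrtCount_neg_two_eq {n : ℕ} (hn : n ≠ 0) (h4 : ¬ 4 ∣ n)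
    (h : ∀ p : ℕ, p.Prime → p ∣ n → p ≠ 2 → p % 8 = 1 ∨ p % 8 = 3) :
    sqrtCount (-2) n = 2 ^ (n.primeFactors.erase 2).card :=
  sqrtCount_eq hn h4 fun p hp hd hp2 =>
    ⟨fun h' => not_dvd_two hp hp2 ((dvd_neg).1 h'),
      (exists_sq_add_two_iff hp hp2).2 (h p hp hd hp2)⟩

/-! ### Representations and the square roots they belong to -/

/-- Thue's lemma: a box with more than `n` points contains two on which `x - z * y` agrees modulo
`n`; their difference is the small vector. -/
theorem exists_small_modEq {n : ℕ} (hn : 0 < n) (z : ℤ) :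
    ∃ x y : ℤ, (x ≠ 0 ∨ y ≠ 0) ∧ (n : ℤ) ∣ x - z * y ∧ x ^ 2 ≤ n ∧ y ^ 2 < n := by
  have : NeZero n := ⟨hn.ne'⟩
  set s := Nat.sqrt n
  -- Using `n - 1` makes the bound on `y` strict. This later excludes the values `3 * n` of `x ^ 2 +
  -- 2 * y ^ 2` and `-2 * n` of `x ^ 2 - 2 * y ^ 2`.
  set r := Nat.sqrt (n - 1)
  have hs : s * s ≤ n := Nat.sqrt_le n
  have hs' : n < (s + 1) * (s + 1) := Nat.lt_succ_sqrt n
  have hr : r * r ≤ n - 1 := Nat.sqrt_le (n - 1)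
  have hr' : n - 1 < (r + 1) * (r + 1) := Nat.lt_succ_sqrt (n - 1)
  have hcard : n < (s + 1) * (r + 1) := by
    by_contra hlt
    have h1 : n ≤ (r + 1) * (r + 1) := by omega
    have h2 : ((s + 1) * (r + 1)) * ((s + 1) * (r + 1)) ≤ n * n :=
      Nat.mul_le_mul (not_lt.1 hlt) (not_lt.1 hlt)
    have h3 : n * n < ((s + 1) * (s + 1)) * ((r + 1) * (r + 1)) :=
      Nat.mul_lt_mul_of_lt_of_le hs' h1 (by positivity)
    have h4 : ((s + 1) * (s + 1)) * ((r + 1) * (r + 1)) =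
      ((s + 1) * (r + 1)) * ((s + 1) * (r + 1)) := by ring
    omega
  let f : Fin (s + 1) × Fin (r + 1) → ZMod n := fun v => ((v.1 : ℕ) : ZMod n) - z * ((v.2 : ℕ) : ZMod n)
  obtain ⟨v, w, hne, hvw⟩ := Fintype.exists_ne_map_eq_of_card_lt f (by simpa [ZMod.card] using hcard)
  refine ⟨(v.1 : ℕ) - (w.1 : ℕ), (v.2 : ℕ) - (w.2 : ℕ), ?_, ?_, ?_, ?_⟩
  · by_contra! h
    apply hne
    ext <;> omega
  · refine (ZMod.intCast_zmod_eq_zero_iff_dvd _ n).1 ?_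
    have hvw' : ((v.1 : ℕ) : ZMod n) - z * ((v.2 : ℕ) : ZMod n) =
      ((w.1 : ℕ) : ZMod n) - z * ((w.2 : ℕ) : ZMod n) := hvw
    push_cast
    linear_combination hvw'
  · have h1 := v.1.isLt
    have h2 := w.1.isLt
    have : ((v.1 : ℕ) - (w.1 : ℕ) : ℤ) ^ 2 ≤ (s : ℤ) ^ 2 := sq_le_sq' (by omega) (by omega)
    have : (s : ℤ) * s ≤ n := by exact_mod_cast hs
    nlinarith
  · have h1 := v.2.isLt
    have h2 := w.2.isLt
    have : ((v.2 : ℕ) - (w.2 : ℕ) : ℤ) ^ 2 ≤ (r : ℤ) ^ 2 := sq_le_sq' (by omega) (by omega)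
    have : (r : ℤ) * r < n := by exact_mod_cast (by omega : r * r < n)
    nlinarith

/-- A representation of `±n` by `x² - d y²` that belongs to a square root of `d` modulo `n`
is proper. -/
theorem isCoprime_of_dvd_sub {n d z x y : ℤ} (hn : n ≠ 0) (hz : n ∣ z ^ 2 - d)
    (hxy : n ∣ x - z * y) (h : x ^ 2 - d * y ^ 2 = n ∨ x ^ 2 - d * y ^ 2 = -n) :
    IsCoprime x y := by
  rw [Int.isCoprime_iff_gcd_eq_one]
  obtain ⟨x', hx⟩ := Int.gcd_dvd_left x y
  obtain ⟨y', hy⟩ := Int.gcd_dvd_right x y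
  set g : ℤ := (Int.gcd x y : ℤ) with hg
  set Q := x' ^ 2 - d * y' ^ 2 with hQ
  have hnQ : n = g * (g * Q) ∨ n = -(g * (g * Q)) := by
    rw [hx, hy] at h
    rcases h with h | h
    · left; rw [← h, hQ]; ring
    · right; rw [← neg_eq_iff_eq_neg, ← h, hQ]; ring
  have hdn : g * (g * Q) ∣ n := by
    rcases hnQ with h | h <;> rw [h]
    exact (dvd_neg).2 dvd_rfl
  have hg0 : g ≠ 0 := by rintro h0; simp [h0, hn] at hnQ
  have hQ0 : Q ≠ 0 := by rintro h0; simp [h0, hn] at hnQ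
  -- With `n = ±g ^ 2 * Q`, cancelling one `g` leaves enough divisibility to get `g * Q ∣ Q`, hence
  -- `g ∣ 1`.
  have h1 : g * Q ∣ x' - z * y' := by
    have : g * (g * Q) ∣ g * (x' - z * y') := by
      have h2 := hdn.trans hxy
      rw [hx, hy] at h2
      rwa [show g * x' - z * (g * y') = g * (x' - z * y') by ring] at h2
    exact (mul_dvd_mul_iff_left hg0).1 this
  have h2 : g * Q ∣ Q := by
    have h3 := (h1.mul_right (x' + z * y')).add
      ((((dvd_mul_left (g * Q) g).trans hdn).trans hz).mul_right (y' ^ 2))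
    rwa [show (x' - z * y') * (x' + z * y') + (z ^ 2 - d) * y' ^ 2 = Q by rw [hQ]; ring] at h3
  have h3 : g ∣ 1 := by
    rw [← mul_dvd_mul_iff_right hQ0, one_mul]; exact h2
  have h4 : Int.gcd x y ∣ 1 := Int.natCast_dvd_natCast.1 (by simpa only [← hg, Nat.cast_one] using h3)
  exact Nat.dvd_one.1 h4

theorem isCoprime_right_of_rep {n d x y : ℤ} (hxy : IsCoprime x y)
    (h : x ^ 2 - d * y ^ 2 = n ∨ x ^ 2 - d * y ^ 2 = -n) : IsCoprime y n := by
  have h1 : IsCoprime y (x ^ 2 - d * y ^ 2) := by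
    have h2 : IsCoprime y (x ^ 2) := (hxy.symm).pow_right
    have := h2.add_mul_left_right (-d * y)
    rwa [show x ^ 2 + y * (-d * y) = x ^ 2 - d * y ^ 2 by ring] at this
  rcases h with h | h <;> rw [h] at h1
  · exact h1
  · exact (IsCoprime.neg_right_iff _ _).1 h1

/-- A proper representation of `±n` by `x² - d y²` yields a square root of `d` modulo `n`. -/
theorem exists_root_of_rep {n d x y : ℤ} (hxy : IsCoprime x y)
    (h : x ^ 2 - d * y ^ 2 = n ∨ x ^ 2 - d * y ^ 2 = -n) :
    ∃ z : ℤ, n ∣ z ^ 2 - d ∧ n ∣ x - z * y := by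
  have hy := isCoprime_right_of_rep hxy h
  obtain ⟨u, v, huv⟩ := hy
  have hn : n ∣ x ^ 2 - d * y ^ 2 := by
    rcases h with h | h <;> rw [h]
    exact (dvd_neg).2 dvd_rfl
  obtain ⟨c, hc⟩ := hn
  -- `u` inverts `y` modulo `n`, so the root is the quotient `x / y`.
  refine ⟨x * u, ⟨u ^ 2 * c - d * v * (1 + u * y), ?_⟩, ⟨x * v, ?_⟩⟩
  · linear_combination u ^ 2 * hc + d * (1 + u * y) * huv
  · linear_combination -x * huv

/-- If a set of representations, symmetric under `x ↦ -x`, corresponds bijectively to the square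
roots of `d` modulo `n`, then half of the square roots belong to representations with `0 < x`. -/
theorem two_mul_ncard_eq_sqrtCount {d : ℤ} {n : ℕ} (hn : n ≠ 0) (T : Set (ℤ × ℤ))
    (hT : ∀ v ∈ T, ∃ z : ℤ, (n : ℤ) ∣ z ^ 2 - d ∧ (n : ℤ) ∣ v.1 - z * v.2)
    (hcop : ∀ v ∈ T, IsCoprime v.2 (n : ℤ))
    (hpos : ∀ v ∈ T, v.1 ≠ 0) (hneg : ∀ v ∈ T, (-v.1, v.2) ∈ T)
    (huniq : ∀ z : ℤ, (n : ℤ) ∣ z ^ 2 - d → ∃! v : ℤ × ℤ, v ∈ T ∧ (n : ℤ) ∣ v.1 - z * v.2) :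
    2 * {v | v ∈ T ∧ 0 < v.1}.ncard = sqrtCount d n := by
  have : NeZero n := ⟨hn⟩
  have hroot : ∀ z : ℤ, (z : ZMod n) ^ 2 = (d : ZMod n) ↔ (n : ℤ) ∣ z ^ 2 - d := fun z => by
    rw [← ZMod.intCast_zmod_eq_zero_iff_dvd, ← sub_eq_zero]; push_cast; rfl
  choose g hg1 hg2 using hT
  let F : T → {z : ZMod n // z ^ 2 = (d : ZMod n)} := fun v =>
    ⟨(g v.1 v.2 : ZMod n), (hroot _).2 (hg1 v.1 v.2)⟩
  have hF : Function.Bijective F := by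
    constructor
    · intro v w hvw
      have hvw' : ((g v.1 v.2 : ℤ) : ZMod n) = (g w.1 w.2 : ZMod n) := congrArg Subtype.val hvw
      have hd : (n : ℤ) ∣ g w.1 w.2 - g v.1 v.2 := (ZMod.intCast_eq_intCast_iff_dvd_sub _ _ _).1 hvw'
      refine Subtype.ext ((huniq _ (hg1 v.1 v.2)).unique ⟨v.2, hg2 v.1 v.2⟩ ⟨w.2, ?_⟩)
      have := (hg2 w.1 w.2).add (hd.mul_right w.1.2)
      rwa [show w.1.1 - g w.1 w.2 * w.1.2 + (g w.1 w.2 - g v.1 v.2) * w.1.2 =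
        w.1.1 - g v.1 v.2 * w.1.2 by ring] at this
    · rintro ⟨z, hz⟩
      obtain ⟨z, rfl⟩ := ZMod.intCast_surjective z
      obtain ⟨v, ⟨hv, hvz⟩, -⟩ := huniq z ((hroot z).1 hz)
      refine ⟨⟨v, hv⟩, Subtype.ext ?_⟩
      refine (ZMod.intCast_eq_intCast_iff_dvd_sub _ _ _).2 ?_
      -- Both roots carry `v.2` to `v.1` modulo `n`; invertibility of `v.2` identifies them.
      have h1 : (n : ℤ) ∣ (z - g v hv) * v.2 := by
        have := dvd_sub (hg2 v hv) hvz
        rwa [show v.1 - g v hv * v.2 - (v.1 - z * v.2) = (z - g v hv) * v.2 by ring] at this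
      exact (hcop v hv).symm.dvd_of_dvd_mul_right h1
  have hcard : T.ncard = sqrtCount d n := Nat.card_eq_of_bijective F hF
  have hfin : T.Finite := Set.finite_coe_iff.1 (Finite.of_injective F hF.1)
  have hsplit : T = {v | v ∈ T ∧ 0 < v.1} ∪ {v | v ∈ T ∧ v.1 < 0} := by
    ext v
    constructor
    · intro hv
      rcases lt_or_gt_of_ne (hpos v hv) with h | h
      · exact Or.inr ⟨hv, h⟩
      · exact Or.inl ⟨hv, h⟩
    · rintro (h | h) <;> exact h.1
  have himg : {v | v ∈ T ∧ v.1 < 0} = (fun v : ℤ × ℤ => (-v.1, v.2)) '' {v | v ∈ T ∧ 0 < v.1} := by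
    ext v
    constructor
    · rintro ⟨hv, h⟩
      exact ⟨(-v.1, v.2), ⟨hneg v hv, by simpa using h⟩, by simp⟩
    · rintro ⟨w, ⟨hw, h⟩, rfl⟩
      exact ⟨hneg w hw, by simpa using h⟩
  have hinj : Function.Injective (fun v : ℤ × ℤ => (-v.1, v.2)) := by
    intro v w h
    simpa [Prod.ext_iff] using h
  rw [← hcard]
  conv_rhs => rw [hsplit]
  rw [Set.ncard_union_eq ?_ (hfin.subset fun v h => h.1) (hfin.subset fun v h => h.1), himg,
    Set.ncard_image_of_injective _ hinj, two_mul]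
  rw [Set.disjoint_left]
  rintro v ⟨-, h⟩ ⟨-, h'⟩
  exact lt_asymm h h'

theorem DefRep.sub_eq {n : ℕ} {x y : ℤ} (h : DefRep n x y) :
    x ^ 2 - -2 * y ^ 2 = n ∨ x ^ 2 - -2 * y ^ 2 = -n := by
  left; rw [← h]; ring

theorem IndefRep.sub_eq {n : ℕ} {x y : ℤ} (h : IndefRep n x y) :
    x ^ 2 - 2 * y ^ 2 = n ∨ x ^ 2 - 2 * y ^ 2 = -n := Or.inr h

theorem not_four_dvd_of_root {n : ℕ} {d z : ℤ} (hd : d = 2 ∨ d = -2)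
    (hz : (n : ℤ) ∣ z ^ 2 - d) : ¬ 4 ∣ n := by
  intro h4
  have h : (4 : ℤ) ∣ z ^ 2 - d := (by exact_mod_cast h4 : (4 : ℤ) ∣ n).trans hz
  rcases Int.even_or_odd' z with ⟨c, rfl | rfl⟩
  · have : (4 : ℤ) ∣ d := by
      have := (Dvd.intro (c ^ 2) rfl : (4 : ℤ) ∣ 4 * c ^ 2).sub h
      rwa [show 4 * c ^ 2 - ((2 * c) ^ 2 - d) = d by ring] at this
    omega
  · have : (4 : ℤ) ∣ 1 - d := by
      have := h.sub (Dvd.intro (c ^ 2 + c) rfl : (4 : ℤ) ∣ 4 * (c ^ 2 + c))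
      rwa [show (2 * c + 1) ^ 2 - d - 4 * (c ^ 2 + c) = 1 - d by ring] at this
    omega

theorem dvd_form_of_root {n d z x y : ℤ} (hz : n ∣ z ^ 2 - d) (hxy : n ∣ x - z * y) :
    n ∣ x ^ 2 - d * y ^ 2 := by
  have := (hxy.mul_right (x + z * y)).add (hz.mul_right (y ^ 2))
  rwa [show (x - z * y) * (x + z * y) + (z ^ 2 - d) * y ^ 2 = x ^ 2 - d * y ^ 2 by ring] at this

/-! ### Existence of a representation for each root -/

/-- On Thue's vector the form is a multiple of `n` strictly between `0` and `3 * n`; the value `2 *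
n` is reduced to `n` by dividing by `√-2`. -/
theorem exists_defRep_of_root {n : ℕ} (hn : 0 < n) {z : ℤ} (hz : (n : ℤ) ∣ z ^ 2 - -2) :
    ∃ x y : ℤ, DefRep n x y ∧ (n : ℤ) ∣ x - z * y := by
  obtain ⟨x, y, h0, hxy, hx, hy⟩ := exists_small_modEq hn z
  obtain ⟨m, hm⟩ := dvd_form_of_root hz hxy
  have hn' : (0 : ℤ) < n := by exact_mod_cast hn
  have hpos : 0 < x ^ 2 + 2 * y ^ 2 := by
    rcases h0 with h | h
    · have := pow_pos (abs_pos.2 h) 2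
      rw [sq_abs] at this
      positivity
    · have := pow_pos (abs_pos.2 h) 2
      rw [sq_abs] at this
      positivity
  have hm0 : 0 < m := by
    by_contra! h
    nlinarith
  have hm3 : m < 3 := by
    by_contra! h
    nlinarith
  obtain rfl | rfl : m = 1 ∨ m = 2 := by omega
  · exact ⟨x, y, by unfold DefRep; linarith, hxy⟩
  · have hxe : (2 : ℤ) ∣ x := Int.prime_two.dvd_of_dvd_pow (n := 2) ⟨n - y ^ 2, by linarith⟩
    obtain ⟨w, rfl⟩ := hxe
    have hw : y ^ 2 + 2 * w ^ 2 = n := by linarith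
    -- `2w + y√-2 = √-2 (y - w√-2)`; the negative of the cofactor is taken.
    refine ⟨-y, w, by unfold DefRep; linarith, ?_⟩
    have h2 : (n : ℤ) ∣ 2 * (-y - z * w) := by
      have := ((hz.mul_right y).add (hxy.mul_left z)).neg_right
      rwa [show -((z ^ 2 - -2) * y + z * (2 * w - z * y)) = 2 * (-y - z * w) by ring] at this
    -- The factor `2` in `h2` cancels at once for odd `n`; for `n = 2 * l` with `l` odd,
    -- divisibility by `2` and by `l` is shown separately.
    by_cases hpar : 2 ∣ n
    · obtain ⟨l, rfl⟩ := hpar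
      have hl : ¬ (2 : ℤ) ∣ l := by
        have := not_four_dvd_of_root (Or.inr rfl) hz
        omega
      push_cast at *
      have hye : (2 : ℤ) ∣ y := Int.prime_two.dvd_of_dvd_pow (n := 2) ⟨l - w ^ 2, by linarith⟩
      have hze : (2 : ℤ) ∣ z := by
        refine Int.prime_two.dvd_of_dvd_pow (n := 2) ?_
        have := ((Dvd.intro (l : ℤ) rfl : (2 : ℤ) ∣ 2 * l).trans hz).sub (dvd_refl (2 : ℤ))
        rwa [show z ^ 2 - -2 - 2 = z ^ 2 by ring] at this
      have he : (2 : ℤ) ∣ -y - z * w := (hye.neg_right).sub (hze.mul_right w)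
      exact IsCoprime.mul_dvd ((Int.prime_two.coprime_iff_not_dvd).2 hl) he
        ((mul_dvd_mul_iff_left two_ne_zero).1 h2)
    · have hl : ¬ (2 : ℤ) ∣ n := by omega
      exact ((Int.prime_two.coprime_iff_not_dvd).2 hl).symm.dvd_of_dvd_mul_left h2

/-- On Thue's vector the form is `-n`, `0` or `n`. The value `0` contradicts the irrationality of
`√2`; the value `n` forces `y = 0`, so `n ∣ x` and `x ^ 2 = n`, impossible for `n > 1`. -/
theorem exists_indefRep_of_root {n : ℕ} (hn : 1 < n) {z : ℤ} (hz : (n : ℤ) ∣ z ^ 2 - 2) :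
    ∃ x y : ℤ, IndefRep n x y ∧ (n : ℤ) ∣ x - z * y := by
  obtain ⟨x, y, h0, hxy, hx, hy⟩ := exists_small_modEq (zero_lt_one.trans hn) z
  obtain ⟨m, hm⟩ := dvd_form_of_root hz hxy
  have hn' : (1 : ℤ) < n := by exact_mod_cast hn
  have hm2 : -2 < m := by
    by_contra! h
    nlinarith [sq_nonneg x]
  have hm1 : m ≤ 1 := by
    by_contra! h
    nlinarith [sq_nonneg y]
  obtain rfl | rfl | rfl : m = -1 ∨ m = 0 ∨ m = 1 := by omega
  · exact ⟨x, y, by unfold IndefRep; linarith, hxy⟩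
  · exfalso
    have hy0 : y ≠ 0 := by
      rintro rfl
      have : x ^ 2 = 0 := by linarith
      have := pow_eq_zero_iff (two_ne_zero) |>.1 this
      simp_all
    have h2 : Irrational (√2) := irrational_sqrt_two
    apply irrational_iff_ne_rational _ |>.1 h2 |x| |y| (by simpa using hy0)
    have h3 : ((|x| : ℤ) : ℝ) ^ 2 = 2 * ((|y| : ℤ) : ℝ) ^ 2 := by
      have : |x| ^ 2 = 2 * |y| ^ 2 := by rw [sq_abs, sq_abs]; linarith
      exact_mod_cast this
    have hy' : (0 : ℝ) < ((|y| : ℤ) : ℝ) := by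
      have := abs_pos.2 hy0
      exact_mod_cast this
    rw [Real.sqrt_eq_iff_mul_self_eq (by norm_num) (by positivity)]
    field_simp
    linarith
  · exfalso
    have hy0 : y = 0 := by
      have : y ^ 2 ≤ 0 := by linarith
      exact pow_eq_zero_iff (two_ne_zero) |>.1 (le_antisymm this (sq_nonneg y))
    subst hy0
    have hx2 : x ^ 2 = n := by linarith
    have h1 : (n : ℤ) ∣ x := by simpa using hxy
    have hx0 : x ≠ 0 := by rintro rfl; simp at h0
    have h2 := Int.le_of_dvd (abs_pos.2 hx0) ((dvd_abs _ _).2 h1)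
    rw [← sq_abs] at hx2
    nlinarith

/-! ### Uniqueness of the normalized representation -/

/-- `n` divides both coordinates of `(x' + y'√-2)` times the conjugate of `(x + y√-2)`, so the
quotient is a unit of `ℤ[√-2]`, that is `±1`; positivity of `y` and `y'` fixes the sign. -/
theorem unique_defRep_of_root {n z x y x' y' : ℤ} (hn : 0 < n) (hz : n ∣ z ^ 2 - -2)
    (h : x ^ 2 + 2 * y ^ 2 = n) (h' : x' ^ 2 + 2 * y' ^ 2 = n) (hy : 0 < y) (hy' : 0 < y')
    (hxy : n ∣ x - z * y) (hxy' : n ∣ x' - z * y') : x = x' ∧ y = y' := by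
  obtain ⟨v, hv⟩ : n ∣ x * y' - x' * y := by
    have := (hxy.mul_right y').sub (hxy'.mul_right y)
    rwa [show (x - z * y) * y' - (x' - z * y') * y = x * y' - x' * y by ring] at this
  obtain ⟨u, hu⟩ : n ∣ x * x' + 2 * (y * y') := by
    have := ((hxy.mul_right x').add (hxy'.mul_right (z * y))).add (hz.mul_right (y * y'))
    rwa [show (x - z * y) * x' + (x' - z * y') * (z * y) + (z ^ 2 - -2) * (y * y') =
      x * x' + 2 * (y * y') by ring] at this
  have huv : u ^ 2 + 2 * v ^ 2 = 1 := by
    have h1 : n ^ 2 * (u ^ 2 + 2 * v ^ 2) = n ^ 2 * 1 := by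
      calc n ^ 2 * (u ^ 2 + 2 * v ^ 2) = (n * u) ^ 2 + 2 * (n * v) ^ 2 := by ring
        _ = (x ^ 2 + 2 * y ^ 2) * (x' ^ 2 + 2 * y' ^ 2) := by rw [← hu, ← hv]; ring
        _ = n ^ 2 * 1 := by rw [h, h']; ring
    exact mul_left_cancel₀ (by positivity) h1
  have hv0 : v = 0 := by
    by_contra hv0
    have := Int.one_le_abs hv0
    nlinarith [sq_abs v, sq_nonneg u]
  subst hv0
  have hx1 : x' = u * x := mul_left_cancel₀ hn.ne' (by
    linear_combination x * hu - 2 * y * hv - x' * h)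
  have hy1 : y' = u * y := mul_left_cancel₀ hn.ne' (by
    linear_combination y * hu + x * hv - y' * h)
  have hu1 : u = 1 := by
    have hu0 : 0 < u := pos_of_mul_pos_left (hy1 ▸ hy') hy.le
    nlinarith
  subst hu1
  simp_all

theorem sq_lt_of_abs_lt {x y n : ℤ} (h : x ^ 2 - 2 * y ^ 2 = -n) (hxy : |x| < y) : y ^ 2 < n := by
  have := sq_lt_sq' (neg_lt_of_abs_lt hxy) (lt_of_abs_lt hxy)
  linarith

/-- Two reduced representations of `-n` by `x² - 2y²` that are associated by an element of
determinant divisible by `n` coincide. -/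
theorem unique_reduced {n x y x' y' : ℤ}
    (h : x ^ 2 - 2 * y ^ 2 = -n) (h' : x' ^ 2 - 2 * y' ^ 2 = -n) (hy : |x| < y) (hy' : |x'| < y')
    (hdet : n ∣ x * y' - x' * y) (hinner : n ∣ x * x' - 2 * (y * y')) : x = x' ∧ y = y' := by
  obtain ⟨v, hv⟩ := hdet
  obtain ⟨u, hu⟩ := hinner
  have b := sq_lt_of_abs_lt h hy
  have b' := sq_lt_of_abs_lt h' hy'
  have hn : 0 < n := lt_of_le_of_lt (sq_nonneg y) b
  have hy0 : 0 < y := (abs_nonneg x).trans_lt hy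
  have hy0' : 0 < y' := (abs_nonneg x').trans_lt hy'
  have huv : u ^ 2 - 2 * v ^ 2 = 1 := by
    have h1 : n ^ 2 * (u ^ 2 - 2 * v ^ 2) = n ^ 2 * 1 := by
      calc n ^ 2 * (u ^ 2 - 2 * v ^ 2) = (n * u) ^ 2 - 2 * (n * v) ^ 2 := by ring
        _ = (x ^ 2 - 2 * y ^ 2) * (x' ^ 2 - 2 * y' ^ 2) := by rw [← hu, ← hv]; ring
        _ = n ^ 2 * 1 := by rw [h, h']; ring
    exact mul_left_cancel₀ (by positivity) h1
  -- The determinant is at most `2 * y * y' ≤ y ^ 2 + y' ^ 2`, and reducedness gives `y ^ 2, y' ^ 2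
  -- < n`.
  have hbound : |x * y' - x' * y| < 2 * n := by
    have h1 : |x * y'| ≤ y * y' := by
      rw [abs_mul, abs_of_pos hy0']; exact mul_le_mul_of_nonneg_right hy.le hy0'.le
    have h2 : |x' * y| ≤ y' * y := by
      rw [abs_mul, abs_of_pos hy0]; exact mul_le_mul_of_nonneg_right hy'.le hy0.le
    have h3 := abs_sub (x * y') (x' * y)
    nlinarith [sq_nonneg (y - y')]
  rw [hv, abs_mul, abs_of_pos hn] at hbound
  have hv2 : |v| < 2 := by nlinarith
  -- `v = ±1` would require `u ^ 2 = 3`.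
  have hv0 : v = 0 := by
    obtain ⟨h1, h2⟩ := abs_lt.1 hv2
    obtain rfl | rfl | rfl : v = -1 ∨ v = 0 ∨ v = 1 := by omega
    · exfalso
      have h1 : u < 2 := by nlinarith
      have h2 : -2 < u := by nlinarith
      obtain rfl | rfl | rfl : u = -1 ∨ u = 0 ∨ u = 1 := by omega
      all_goals norm_num at huv
    · rfl
    · exfalso
      have h1 : u < 2 := by nlinarith
      have h2 : -2 < u := by nlinarith
      obtain rfl | rfl | rfl : u = -1 ∨ u = 0 ∨ u = 1 := by omega
      all_goals norm_num at huv
  subst hv0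
  have hx1 : x' = -u * x := mul_left_cancel₀ hn.ne' (by
    linear_combination -x * hu - 2 * y * hv + x' * h)
  have hy1 : y' = -u * y := mul_left_cancel₀ hn.ne' (by
    linear_combination -y * hu - x * hv + y' * h)
  have hu1 : -u = 1 := by
    have hu0 : 0 < -u := pos_of_mul_pos_left (hy1 ▸ hy0') hy0.le
    nlinarith
  rw [hu1] at hx1 hy1
  simp_all

/-! ### Families and reduction -/

/-- The automorphism is multiplication of `x + y√2` by the unit `3 + 2√2`, so its powers multiply by
units of norm 1. -/
theorem auto_zpow (n : ℤ) : ∃ u v : ℤ, u ^ 2 - 2 * v ^ 2 = 1 ∧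
    ∀ x y : ℤ, (auto ^ n) (x, y) = (u * x + 2 * v * y, v * x + u * y) := by
  induction n using Int.induction_on with
  | zero => exact ⟨1, 0, by norm_num, fun x y => by simp⟩
  | succ n ih =>
    obtain ⟨u, v, h, huv⟩ := ih
    refine ⟨3 * u + 4 * v, 2 * u + 3 * v, by linear_combination h, fun x y => ?_⟩
    rw [add_comm, zpow_one_add, Equiv.Perm.mul_apply, huv]
    ext <;> simp [auto] <;> ring
  | pred n ih =>
    obtain ⟨u, v, h, huv⟩ := ih
    refine ⟨3 * u - 4 * v, -2 * u + 3 * v, by linear_combination h, fun x y => ?_⟩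
    rw [sub_eq_add_neg, add_comm, zpow_add, Equiv.Perm.mul_apply, huv, zpow_neg_one]
    ext <;> simp [auto, Equiv.Perm.inv_def, Equiv.symm] <;> ring

theorem exists_of_mem_family {v w : ℤ × ℤ} (h : w ∈ family v) : ∃ r s : ℤ,
    r ^ 2 - 2 * s ^ 2 = 1 ∧ w.1 = r * v.1 + 2 * s * v.2 ∧ w.2 = s * v.1 + r * v.2 := by
  obtain ⟨n, rfl⟩ := h
  obtain ⟨r, s, h, hrs⟩ := auto_zpow n
  exact ⟨r, s, h, by rw [← Prod.mk.eta (p := v), hrs], by rw [← Prod.mk.eta (p := v), hrs]⟩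

theorem family_symm {v w : ℤ × ℤ} (h : w ∈ family v) : v ∈ family w := by
  obtain ⟨n, rfl⟩ := h
  exact ⟨-n, by rw [← Equiv.Perm.mul_apply, ← zpow_add]; simp⟩

theorem family_trans {u v w : ℤ × ℤ} (h : v ∈ family u) (h' : w ∈ family v) : w ∈ family u := by
  obtain ⟨n, rfl⟩ := h
  obtain ⟨m, rfl⟩ := h'
  exact ⟨m + n, by rw [← Equiv.Perm.mul_apply, ← zpow_add]⟩

theorem self_mem_family (v : ℤ × ℤ) : v ∈ family v := ⟨0, by simp⟩

theorem indefRep_of_mem_family {a : ℕ} {v w : ℤ × ℤ} (h : w ∈ family v)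
    (hv : IndefRep a v.1 v.2) : IndefRep a w.1 w.2 := by
  obtain ⟨r, s, h, h1, h2⟩ := exists_of_mem_family h
  unfold IndefRep at *
  rw [h1, h2]
  linear_combination (v.1 ^ 2 - 2 * v.2 ^ 2) * h + hv

theorem isCoprime_of_mem_family {v w : ℤ × ℤ} (h : w ∈ family v)
    (hv : IsCoprime v.1 v.2) : IsCoprime w.1 w.2 := by
  obtain ⟨r, s, h, h1, h2⟩ := exists_of_mem_family (family_symm h)
  obtain ⟨a, b, hab⟩ := hv
  exact ⟨a * r + b * s, a * 2 * s + b * r, by rw [← hab, h1, h2]; ring⟩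

/-- The root is an invariant of the family, so reducing a representation keeps its root. -/
theorem dvd_of_mem_family {n z : ℤ} {v w : ℤ × ℤ} (h : w ∈ family v) (hz : n ∣ z ^ 2 - 2)
    (hv : n ∣ v.1 - z * v.2) : n ∣ w.1 - z * w.2 := by
  obtain ⟨r, s, h, h1, h2⟩ := exists_of_mem_family h
  have := (hv.mul_right (r - s * z)).sub (hz.mul_right (s * v.2))
  rwa [show (v.1 - z * v.2) * (r - s * z) - (z ^ 2 - 2) * (s * v.2) = w.1 - z * w.2 by
    rw [h1, h2]; ring] at this

theorem eq_of_mem_family {a : ℕ} {v w : ℤ × ℤ} (h : w ∈ family v) (hv : IndefRep a v.1 v.2)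
    (hr : |v.1| < v.2) (hr' : |w.1| < w.2) : v = w := by
  have hw := indefRep_of_mem_family h hv
  obtain ⟨r, s, h, h1, h2⟩ := exists_of_mem_family h
  unfold IndefRep at *
  have := unique_reduced hv hw hr hr' ⟨-s, by rw [h1, h2]; linear_combination s * hv⟩
    ⟨-r, by rw [h1, h2]; linear_combination r * hv⟩
  exact Prod.ext this.1 this.2

/-- Descent on `y`: while `|x| > y`, the automorphism or its inverse replaces `y` by `3 * y - 2 *
|x|`, which is positive and smaller than `y`. -/
theorem exists_reduced {a : ℕ} (ha : 1 < a) {v : ℤ × ℤ} (hv : IndefRep a v.1 v.2)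
    (hc : IsCoprime v.1 v.2) (hpos : 0 < v.2) : ∃ w ∈ family v, |w.1| < w.2 := by
  obtain ⟨N, hN⟩ : ∃ N : ℕ, v.2 ≤ N := ⟨v.2.toNat, by omega⟩
  induction N generalizing v with
  | zero => exfalso; push_cast at hN; omega
  | succ N ih =>
    obtain ⟨x, y⟩ := v
    simp only at hv hc hpos hN
    unfold IndefRep at hv
    have ha' : (1 : ℤ) < a := by exact_mod_cast ha
    -- Equality and coprimality would give `|x| = y = 1`, hence `a = 1`.
    have hne : |x| ≠ y := by
      intro h
      have h1 : IsCoprime |x| y := by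
        rcases abs_choice x with h2 | h2 <;> rw [h2]
        · exact hc
        · exact hc.neg_left
      rw [h, isCoprime_self, Int.isUnit_iff] at h1
      have h2 : y = 1 := by omega
      rw [← sq_abs x, h, h2] at hv
      linarith
    -- Positivity of the new second coordinate rests on `√2 < 3 / 2`.
    have hlt : ∀ t : ℤ, t ^ 2 - 2 * y ^ 2 = -a → 2 * t < 3 * y := by
      intro t ht
      by_contra! h
      nlinarith
    rcases lt_or_gt_of_ne hne with h | h
    · exact ⟨(x, y), self_mem_family _, h⟩
    · have key : ∀ w ∈ family (x, y), 0 < w.2 → w.2 < y → ∃ w' ∈ family (x, y), |w'.1| < w'.2 := by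
        intro w hw h1 h2
        obtain ⟨w', hw', h3⟩ := ih (indefRep_of_mem_family hw hv) (isCoprime_of_mem_family hw hc)
          h1 (by push_cast at hN; omega)
        exact ⟨w', family_trans hw hw', h3⟩
      rcases abs_choice x with h2 | h2 <;> rw [h2] at h
      · have := hlt x hv
        exact key (3 * x - 4 * y, -2 * x + 3 * y) ⟨-1, by rw [zpow_neg_one]; rfl⟩
          (by simp only; omega) (by simp only; omega)
      · have := hlt (-x) (by rw [← hv]; ring)
        exact key (3 * x + 4 * y, 2 * x + 3 * y) ⟨1, by rw [zpow_one]; rfl⟩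
          (by simp only; omega) (by simp only; omega)

theorem fst_ne_zero_of_indefRep {a : ℕ} (ha : 2 < a) {x y : ℤ} (h : IndefRep a x y)
    (hc : IsCoprime x y) : x ≠ 0 := by
  rintro rfl
  rw [isCoprime_zero_left, Int.isUnit_iff] at hc
  unfold IndefRep at h
  rcases hc with rfl | rfl <;> norm_num at h <;> omega

theorem fst_ne_zero_of_defRep {a : ℕ} (ha : 2 < a) {x y : ℤ} (h : DefRep a x y)
    (hc : IsCoprime x y) : x ≠ 0 := by
  rintro rfl
  rw [isCoprime_zero_left, Int.isUnit_iff] at hc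
  unfold DefRep at h
  rcases hc with rfl | rfl <;> norm_num at h <;> omega

theorem snd_ne_zero_of_defRep {a : ℕ} (ha : 2 < a) {x y : ℤ} (h : DefRep a x y)
    (hc : IsCoprime x y) : y ≠ 0 := by
  rintro rfl
  rw [isCoprime_zero_right, Int.isUnit_iff] at hc
  unfold DefRep at h
  rcases hc with rfl | rfl <;> norm_num at h <;> omega

/-- The family has exactly one reduced member `w`, and `w.1 ≠ 0` because `a > 2`; the sign of `w.1`
decides whether `w` or its mirror image is the positive solution. -/
theorem onePerConjugatePair {a : ℕ} (ha : 2 < a) : OnePerConjugatePair a := by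
  intro v hv hc hpos
  rw [← Int.isCoprime_iff_gcd_eq_one] at hc
  obtain ⟨w, hw, hr⟩ := exists_reduced (by omega) hv hc hpos
  have hrep := indefRep_of_mem_family hw hv
  have h0 := fst_ne_zero_of_indefRep ha hrep (isCoprime_of_mem_family hw hc)
  have huniq : ∀ w' ∈ family v, |w'.1| < w'.2 → w' = w := fun w' hw' hr' =>
    (eq_of_mem_family (family_trans (family_symm hw) hw') hrep hr hr').symm
  refine ⟨(|w.1|, w.2), ⟨?_, abs_pos.2 h0, hr⟩, ?_⟩
  · rcases abs_choice w.1 with h | h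
    · left; rw [h]; exact hw
    · right
      change (-|w.1|, w.2) ∈ family v
      rw [h, neg_neg]; exact hw
  · rintro ⟨x, y⟩ ⟨h | h, h1, h2⟩
    · have := huniq _ h (by simpa [abs_of_pos h1] using h2)
      rw [← this]
      simp [abs_of_pos h1]
    · have h : (-x, y) ∈ family v := h
      have := huniq _ h (by simpa [abs_of_pos h1] using h2)
      rw [← this]
      simp [abs_of_pos h1]

/-! ### Counting proper representations -/

theorem two_mul_ncard_properDef {a : ℕ} (ha : 2 < a) :
    2 * (properDef a).ncard = sqrtCount (-2) a := by
  let T : Set (ℤ × ℤ) := {v | DefRep a v.1 v.2 ∧ IsCoprime v.1 v.2 ∧ 0 < v.2}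
  have hT : properDef a = {v | v ∈ T ∧ 0 < v.1} := by
    ext v
    simp only [properDef, T, Set.mem_ofPred_eq, Int.isCoprime_iff_gcd_eq_one]
    tauto
  rw [hT]
  refine two_mul_ncard_eq_sqrtCount (by omega) T (fun v hv => exists_root_of_rep hv.2.1 hv.1.sub_eq)
    (fun v hv => isCoprime_right_of_rep hv.2.1 hv.1.sub_eq)
    (fun v hv => fst_ne_zero_of_defRep ha hv.1 hv.2.1)
    (fun v hv => ⟨by have := hv.1; unfold DefRep at *; simpa using this, hv.2.1.neg_left, hv.2.2⟩) ?_
  intro z hz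
  obtain ⟨x, y, hrep, hxy⟩ := exists_defRep_of_root (by omega) hz
  have hc : IsCoprime x y := isCoprime_of_dvd_sub (by omega) hz hxy hrep.sub_eq
  have hex : ∃ v : ℤ × ℤ, v ∈ T ∧ (a : ℤ) ∣ v.1 - z * v.2 := by
    rcases lt_or_gt_of_ne (snd_ne_zero_of_defRep ha hrep hc) with h | h
    · refine ⟨(-x, -y), ⟨by unfold DefRep at *; simpa using hrep, hc.neg_neg, by simpa using h⟩, ?_⟩
      have := hxy.neg_right
      rwa [show -(x - z * y) = -x - z * -y by ring] at this
    · exact ⟨(x, y), ⟨hrep, hc, h⟩, hxy⟩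
  obtain ⟨v, hv, hvz⟩ := hex
  refine ⟨v, ⟨hv, hvz⟩, fun w ⟨hw, hwz⟩ => ?_⟩
  have := unique_defRep_of_root (by omega) hz hw.1 hv.1 hw.2.2 hv.2.2 hwz hvz
  exact Prod.ext this.1 this.2

theorem two_mul_ncard_properIndef {a : ℕ} (ha : 2 < a) :
    2 * (properIndef a).ncard = sqrtCount 2 a := by
  -- Reducedness is symmetric under `x ↦ -x`, as the counting lemma requires.
  let T : Set (ℤ × ℤ) := {v | IndefRep a v.1 v.2 ∧ IsCoprime v.1 v.2 ∧ |v.1| < v.2}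
  have hT : properIndef a = {v | v ∈ T ∧ 0 < v.1} := by
    ext v
    simp only [properIndef, T, Set.mem_ofPred_eq, Int.isCoprime_iff_gcd_eq_one]
    constructor
    · rintro ⟨h1, h2, h3, h4⟩
      exact ⟨⟨h1, h2, by rwa [abs_of_pos h3]⟩, h3⟩
    · rintro ⟨⟨h1, h2, h4⟩, h3⟩
      exact ⟨h1, h2, h3, by rwa [abs_of_pos h3] at h4⟩
  rw [hT]
  refine two_mul_ncard_eq_sqrtCount (by omega) T (fun v hv => exists_root_of_rep hv.2.1 hv.1.sub_eq)
    (fun v hv => isCoprime_right_of_rep hv.2.1 hv.1.sub_eq)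
    (fun v hv => fst_ne_zero_of_indefRep ha hv.1 hv.2.1)
    (fun v hv => ⟨by have := hv.1; unfold IndefRep at *; simpa using this, hv.2.1.neg_left,
      by simpa using hv.2.2⟩) ?_
  intro z hz
  obtain ⟨x, y, hrep, hxy⟩ := exists_indefRep_of_root (by omega) hz
  have hc : IsCoprime x y := isCoprime_of_dvd_sub (by omega) hz hxy hrep.sub_eq
  have hy0 : y ≠ 0 := by
    rintro rfl
    unfold IndefRep at hrep
    nlinarith [sq_nonneg x]
  have hex : ∃ v : ℤ × ℤ, (IndefRep a v.1 v.2 ∧ IsCoprime v.1 v.2 ∧ 0 < v.2) ∧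
      (a : ℤ) ∣ v.1 - z * v.2 := by
    rcases lt_or_gt_of_ne hy0 with h | h
    · refine ⟨(-x, -y), ⟨by unfold IndefRep at *; simpa using hrep, hc.neg_neg, by simpa using h⟩, ?_⟩
      have := hxy.neg_right
      rwa [show -(x - z * y) = -x - z * -y by ring] at this
    · exact ⟨(x, y), ⟨hrep, hc, h⟩, hxy⟩
  obtain ⟨v, ⟨hv1, hv2, hv3⟩, hvz⟩ := hex
  obtain ⟨w, hw, hr⟩ := exists_reduced (by omega) hv1 hv2 hv3
  have hwT : w ∈ T := ⟨indefRep_of_mem_family hw hv1, isCoprime_of_mem_family hw hv2, hr⟩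
  have hwz := dvd_of_mem_family hw hz hvz
  refine ⟨w, ⟨hwT, hwz⟩, fun w' ⟨hw', hwz'⟩ => ?_⟩
  have := unique_reduced hw'.1 hwT.1 hw'.2.2 hr (by
      have := (hwz'.mul_right w.2).sub (hwz.mul_right w'.2)
      rwa [show (w'.1 - z * w'.2) * w.2 - (w.1 - z * w.2) * w'.2 =
        w'.1 * w.2 - w.1 * w'.2 by ring] at this) (by
      have := ((hwz'.mul_right w.1).add (hwz.mul_right (z * w'.2))).add (hz.mul_right (w'.2 * w.2))
      rwa [show (w'.1 - z * w'.2) * w.1 + (w.1 - z * w.2) * (z * w'.2) +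
        (z ^ 2 - 2) * (w'.2 * w.2) = w'.1 * w.1 - 2 * (w'.2 * w.2) by ring] at this)
  exact Prod.ext this.1 this.2

/-! ### Which numbers are properly represented -/

theorem DefRep.not_four_dvd {a : ℕ} {t k : ℤ} (h : DefRep a t k) (hc : IsCoprime t k) :
    ¬ 4 ∣ a := by
  obtain ⟨z, hz, -⟩ := exists_root_of_rep hc h.sub_eq
  exact not_four_dvd_of_root (Or.inr rfl) hz

theorem IndefRep.not_four_dvd {a : ℕ} {X Y : ℤ} (h : IndefRep a X Y) (hc : IsCoprime X Y) :
    ¬ 4 ∣ a := by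
  obtain ⟨z, hz, -⟩ := exists_root_of_rep hc h.sub_eq
  exact not_four_dvd_of_root (Or.inl rfl) hz

theorem DefRep.prime_mod_eight {a : ℕ} {t k : ℤ} (h : DefRep a t k) (hc : IsCoprime t k)
    {p : ℕ} (hp : p.Prime) (hp2 : p ≠ 2) (hpa : p ∣ a) : p % 8 = 1 ∨ p % 8 = 3 := by
  obtain ⟨z, hz, -⟩ := exists_root_of_rep hc h.sub_eq
  exact (exists_sq_add_two_iff hp hp2).1 ⟨z, (Int.natCast_dvd_natCast.2 hpa).trans hz⟩

theorem IndefRep.prime_mod_eight {a : ℕ} {X Y : ℤ} (h : IndefRep a X Y) (hc : IsCoprime X Y)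
    {p : ℕ} (hp : p.Prime) (hp2 : p ≠ 2) (hpa : p ∣ a) : p % 8 = 1 ∨ p % 8 = 7 := by
  obtain ⟨z, hz, -⟩ := exists_root_of_rep hc h.sub_eq
  exact (exists_sq_sub_two_iff hp hp2).1 ⟨z, (Int.natCast_dvd_natCast.2 hpa).trans hz⟩

theorem exists_properDef {a : ℕ} (ha : 2 < a) (h4 : ¬ 4 ∣ a)
    (h : ∀ p : ℕ, p.Prime → p ∣ a → p ≠ 2 → p % 8 = 1 ∨ p % 8 = 3) : (properDef a).Nonempty := by
  have h1 := two_mul_ncard_properDef ha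
  rw [sqrtCount_neg_two_eq (by omega) h4 h] at h1
  exact Set.nonempty_of_ncard_ne_zero fun h0 => by
    rw [h0] at h1
    exact absurd h1.symm (by positivity)

theorem exists_properIndef {a : ℕ} (ha : 2 < a) (h4 : ¬ 4 ∣ a)
    (h : ∀ p : ℕ, p.Prime → p ∣ a → p ≠ 2 → p % 8 = 1 ∨ p % 8 = 7) :
    (properIndef a).Nonempty := by
  have h1 := two_mul_ncard_properIndef ha
  rw [sqrtCount_two_eq (by omega) h4 h] at h1
  exact Set.nonempty_of_ncard_ne_zero fun h0 => by
    rw [h0] at h1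
    exact absurd h1.symm (by positivity)

theorem isTwoPrimeProd_of_reps {a : ℕ} {X Y t k : ℤ} (ha : a ≠ 0) (h : IndefRep a X Y)
    (hXY : IsCoprime X Y) (h' : DefRep a t k) (htk : IsCoprime t k) : IsTwoPrimeProd a := by
  refine isTwoPrimeProd_iff.2 ⟨ha, h'.not_four_dvd htk, fun p hp hpa hp2 => ?_⟩
  have h1 := h.prime_mod_eight hXY hp hp2 hpa
  have h2 := h'.prime_mod_eight htk hp hp2 hpa
  omega

theorem IsTwoPrimeProd.exists_reps {a : ℕ} (ha : 2 ≤ a) (h : IsTwoPrimeProd a) :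
    (∃ X Y : ℤ, IndefRep a X Y ∧ Int.gcd X Y = 1) ∧
      (∃ t k : ℤ, DefRep a t k ∧ Int.gcd t k = 1) := by
  rcases eq_or_lt_of_le ha with rfl | ha
  -- For `a = 2` the proper representations have first coordinate zero, so the count of positive
  -- ones does not apply.
  · exact ⟨⟨0, 1, by norm_num [IndefRep], rfl⟩, ⟨0, 1, by norm_num [DefRep], rfl⟩⟩
  · obtain ⟨h0, h4, hp⟩ := isTwoPrimeProd_iff.1 h
    obtain ⟨v, hv, hc, -⟩ := exists_properIndef ha h4 fun p h1 h2 h3 => Or.inl (hp p h1 h2 h3)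
    obtain ⟨w, hw, hc', -⟩ := exists_properDef ha h4 fun p h1 h2 h3 => Or.inl (hp p h1 h2 h3)
    exact ⟨⟨_, _, hv, hc⟩, ⟨_, _, hw, hc'⟩⟩

/-! ### Dividing out the gcd of an improper representation -/

theorem exists_eq_mul_of_gcd_eq {x y : ℤ} {A : ℕ} (hA : A ≠ 0) (h : Int.gcd x y = A) :
    ∃ x' y' : ℤ, x = A * x' ∧ y = A * y' ∧ Int.gcd x' y' = 1 := by
  subst h
  refine ⟨x / Int.gcd x y, y / Int.gcd x y, (Int.mul_ediv_cancel' (Int.gcd_dvd_left x y)).symm,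
    (Int.mul_ediv_cancel' (Int.gcd_dvd_right x y)).symm, ?_⟩
  exact Int.gcd_ediv_gcd_ediv_gcd (Nat.pos_of_ne_zero hA)

theorem indefRep_mul_iff {A b : ℕ} (hA : A ≠ 0) {x y : ℤ} :
    IndefRep (A ^ 2 * b) (A * x) (A * y) ↔ IndefRep b x y := by
  have hA' : ((A : ℤ) ^ 2) ≠ 0 := by positivity
  unfold IndefRep
  push_cast
  constructor
  · intro h
    exact mul_left_cancel₀ hA' (by linear_combination h)
  · intro h
    linear_combination (A : ℤ) ^ 2 * h

theorem defRep_mul_iff {A b : ℕ} (hA : A ≠ 0) {x y : ℤ} :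
    DefRep (A ^ 2 * b) (A * x) (A * y) ↔ DefRep b x y := by
  have hA' : ((A : ℤ) ^ 2) ≠ 0 := by positivity
  unfold DefRep
  push_cast
  constructor
  · intro h
    exact mul_left_cancel₀ hA' (by linear_combination h)
  · intro h
    linear_combination (A : ℤ) ^ 2 * h

theorem gcd_mul_left_eq_iff {A : ℕ} (hA : A ≠ 0) {x y : ℤ} :
    Int.gcd (A * x) (A * y) = A ↔ Int.gcd x y = 1 := by
  rw [Int.gcd_mul_left, Int.natAbs_natCast]
  exact mul_eq_left₀ hA

theorem indefRep_gcd_iff {A b : ℕ} (hA : A ≠ 0) (X Y : ℤ) :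
    (IndefRep (A ^ 2 * b) X Y ∧ Int.gcd X Y = A) ↔
      ∃ X' Y' : ℤ, X = A * X' ∧ Y = A * Y' ∧ IndefRep b X' Y' ∧ Int.gcd X' Y' = 1 := by
  constructor
  · rintro ⟨h, hg⟩
    obtain ⟨x, y, rfl, rfl, h1⟩ := exists_eq_mul_of_gcd_eq hA hg
    exact ⟨x, y, rfl, rfl, (indefRep_mul_iff hA).1 h, h1⟩
  · rintro ⟨x, y, rfl, rfl, h, h1⟩
    exact ⟨(indefRep_mul_iff hA).2 h, (gcd_mul_left_eq_iff hA).2 h1⟩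

theorem defRep_gcd_iff {A b : ℕ} (hA : A ≠ 0) (t k : ℤ) :
    (DefRep (A ^ 2 * b) t k ∧ Int.gcd t k = A) ↔
      ∃ t' k' : ℤ, t = A * t' ∧ k = A * k' ∧ DefRep b t' k' ∧ Int.gcd t' k' = 1 := by
  constructor
  · rintro ⟨h, hg⟩
    obtain ⟨x, y, rfl, rfl, h1⟩ := exists_eq_mul_of_gcd_eq hA hg
    exact ⟨x, y, rfl, rfl, (defRep_mul_iff hA).1 h, h1⟩
  · rintro ⟨x, y, rfl, rfl, h, h1⟩
    exact ⟨(defRep_mul_iff hA).2 h, (gcd_mul_left_eq_iff hA).2 h1⟩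

theorem IndefRep.exists_eq_sq_mul {a A : ℕ} {x y : ℤ}
    (h : IndefRep a (A * x) (A * y)) : ∃ b : ℕ, a = A ^ 2 * b := by
  have : ((A ^ 2 : ℕ) : ℤ) ∣ a := ⟨2 * y ^ 2 - x ^ 2, by
    unfold IndefRep at h; push_cast; linear_combination h⟩
  exact Int.natCast_dvd_natCast.1 this

theorem DefRep.exists_eq_sq_mul {a A : ℕ} {x y : ℤ}
    (h : DefRep a (A * x) (A * y)) : ∃ b : ℕ, a = A ^ 2 * b := by
  have : ((A ^ 2 : ℕ) : ℤ) ∣ a := ⟨x ^ 2 + 2 * y ^ 2, by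
    unfold DefRep at h; push_cast; linear_combination -h⟩
  exact Int.natCast_dvd_natCast.1 this

theorem not_four_dvd_sq_mul {A b : ℕ} (hA : ¬ 2 ∣ A) (hb : ¬ 4 ∣ b) : ¬ 4 ∣ A ^ 2 * b := by
  have h : Nat.Coprime (2 ^ 2) (A ^ 2) := ((Nat.Prime.coprime_iff_not_dvd Nat.prime_two).2 hA).pow 2 2
  exact fun h' => hb (h.dvd_of_dvd_mul_left h')

/-- The proper definite representation forbids `4 ∣ a`, so `A` is odd, and puts the primes of `A` in
the classes `1, 3`. The cofactor is also properly represented by the indefinite form, which leaves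
only class `1` for its odd primes. -/
theorem isDecomp_of_improper_indef {a A : ℕ} {X Y t k : ℤ} (hA : 2 ≤ A)
    (h : IndefRep a X Y) (hg : Int.gcd X Y = A) (hX : 0 < X) (hXY : X < Y)
    (h' : DefRep a t k) (htk : IsCoprime t k) : ∃ b : ℕ, IsDecomp {1, 3} a A b := by
  have hA0 : A ≠ 0 := by omega
  obtain ⟨x, y, rfl, rfl, h1⟩ := exists_eq_mul_of_gcd_eq hA0 hg
  obtain ⟨b, rfl⟩ := h.exists_eq_sq_mul
  have hA' : (0 : ℤ) < A := by omega
  rw [indefRep_mul_iff hA0] at h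
  have hx : 0 < x := pos_of_mul_pos_right hX hA'.le
  have hxy : x < y := lt_of_mul_lt_mul_left hXY hA'.le
  have hb : 2 < b := by
    unfold IndefRep at h
    have : (2 : ℤ) < b := by nlinarith
    exact_mod_cast this
  rw [← Int.isCoprime_iff_gcd_eq_one] at h1
  have h4 := h'.not_four_dvd htk
  have h2A : ¬ 2 ∣ A := by
    rintro ⟨c, rfl⟩
    exact h4 ⟨c ^ 2 * b, by ring⟩
  refine ⟨b, hA, rfl, isPrimeProd_iff.2 ⟨hA0, fun p hp hpA => ?_⟩,
    isTwoPrimeProd_iff.2 ⟨by omega, fun h5 => h4 (h5.mul_left _), fun p hp hpb hp2 => ?_⟩, hb⟩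
  · exact h'.prime_mod_eight htk hp (by rintro rfl; exact h2A hpA)
      ((dvd_pow hpA two_ne_zero).mul_right b)
  · have h5 := h.prime_mod_eight h1 hp hp2 hpb
    have h6 := h'.prime_mod_eight htk hp hp2 (hpb.mul_left _)
    omega

theorem isDecomp_of_improper_def {a A : ℕ} {X Y t k : ℤ} (hA : 2 ≤ A)
    (h : DefRep a t k) (hg : Int.gcd t k = A) (ht : 0 < t) (hk : 0 < k)
    (h' : IndefRep a X Y) (hXY : IsCoprime X Y) : ∃ b : ℕ, IsDecomp {1, 7} a A b := by
  have hA0 : A ≠ 0 := by omega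
  obtain ⟨x, y, rfl, rfl, h1⟩ := exists_eq_mul_of_gcd_eq hA0 hg
  obtain ⟨b, rfl⟩ := h.exists_eq_sq_mul
  have hA' : (0 : ℤ) < A := by omega
  rw [defRep_mul_iff hA0] at h
  have hx : 0 < x := pos_of_mul_pos_right ht hA'.le
  have hy : 0 < y := pos_of_mul_pos_right hk hA'.le
  have hb : 2 < b := by
    unfold DefRep at h
    have : (2 : ℤ) < b := by nlinarith
    exact_mod_cast this
  rw [← Int.isCoprime_iff_gcd_eq_one] at h1
  have h4 := h'.not_four_dvd hXY
  have h2A : ¬ 2 ∣ A := by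
    rintro ⟨c, rfl⟩
    exact h4 ⟨c ^ 2 * b, by ring⟩
  refine ⟨b, hA, rfl, isPrimeProd_iff.2 ⟨hA0, fun p hp hpA => ?_⟩,
    isTwoPrimeProd_iff.2 ⟨by omega, fun h5 => h4 (h5.mul_left _), fun p hp hpb hp2 => ?_⟩, hb⟩
  · exact h'.prime_mod_eight hXY hp (by rintro rfl; exact h2A hpA)
      ((dvd_pow hpA two_ne_zero).mul_right b)
  · have h5 := h.prime_mod_eight h1 hp hp2 hpb
    have h6 := h'.prime_mod_eight hXY hp hp2 (hpb.mul_left _)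
    omega

/-! ### Prime divisors and counts for `a = A ^ 2 * b` -/

section Decomp

variable {r a A b : ℕ}

theorem IsDecomp.two_lt_left {R : Set ℕ} (h : IsDecomp R a A b) : 2 < a := by
  have h1 := h.two_lt
  have h2 : 1 ≤ A ^ 2 := Nat.one_le_pow _ _ (by have := h.two_le; omega)
  rw [h.eq]
  nlinarith

theorem IsDecomp.not_four_dvd {R : Set ℕ} (hR : 2 ∉ R) (h : IsDecomp R a A b) : ¬ 4 ∣ a := by
  rw [h.eq]
  exact not_four_dvd_sq_mul (h.primes_A.odd hR) (isTwoPrimeProd_iff.1 h.primes_b).2.1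

theorem IsDecomp.prime_mod_eight (h : IsDecomp {1, r} a A b) {p : ℕ} (hp : p.Prime)
    (hpa : p ∣ a) (hp2 : p ≠ 2) : p % 8 = 1 ∨ p % 8 = r := by
  rw [h.eq] at hpa
  rcases hp.dvd_mul.1 hpa with h1 | h1
  · exact (isPrimeProd_iff.1 h.primes_A).2 p hp (hp.dvd_of_dvd_pow h1)
  · exact Or.inl ((isTwoPrimeProd_iff.1 h.primes_b).2.2 p hp h1 hp2)

theorem IsDecomp.primeFactors {R : Set ℕ} (h : IsDecomp R a A b) :
    a.primeFactors = A.primeFactors ∪ b.primeFactors := by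
  have h1 := h.two_le
  have h2 := h.two_lt
  rw [h.eq, Nat.primeFactors_mul (by positivity) (by omega), Nat.primeFactors_pow _ two_ne_zero]

theorem IsDecomp.primesMod_eq {R : Set ℕ} (h : IsDecomp R a A b) (s : ℕ) :
    primesMod s a = primesMod s A ∪ primesMod s b := by
  rw [primesMod, h.primeFactors, Finset.filter_union]; rfl

theorem IsTwoPrimeProd.primesMod_eq_empty (h : IsTwoPrimeProd b) {s : ℕ} (h1 : s ≠ 1)
    (h2 : s ≠ 2) : primesMod s b = ∅ := by
  refine Finset.filter_eq_empty_iff.2 fun p hp hps => ?_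
  have hp' := Nat.prime_of_mem_primeFactors hp
  by_cases hp2 : p = 2
  · omega
  · have := (isTwoPrimeProd_iff.1 h).2.2 p hp' (Nat.dvd_of_mem_primeFactors hp) hp2
    omega

theorem IsDecomp.card_pos (h : IsDecomp {1, r} a A b) :
    0 < (primesMod 1 A).card + (primesMod r A).card := by
  obtain ⟨p, hp, hpA⟩ := Nat.exists_prime_and_dvd (show A ≠ 1 by have := h.two_le; omega)
  have hmem : p ∈ A.primeFactors := Nat.mem_primeFactors.2 ⟨hp, hpA, by have := h.two_le; omega⟩
  rcases (isPrimeProd_iff.1 h.primes_A).2 p hp hpA with h1 | h1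
  · exact Nat.add_pos_left (Finset.card_pos.2 ⟨p, Finset.mem_filter.2 ⟨hmem, h1⟩⟩) _
  · exact Nat.add_pos_right _ (Finset.card_pos.2 ⟨p, Finset.mem_filter.2 ⟨hmem, h1⟩⟩)

theorem IsDecomp.card_erase (h : IsDecomp {1, r} a A b) (h1 : r ≠ 1) (h2 : r ≠ 2) :
    (a.primeFactors.erase 2).card = (primesMod 1 a).card + (primesMod r a).card := by
  rw [primesMod, primesMod, ← Finset.card_union_of_disjoint, ← Finset.filter_or]
  · congr 1
    ext p
    simp only [Finset.mem_erase, Finset.mem_filter]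
    constructor
    · rintro ⟨hp2, hp⟩
      exact ⟨hp, h.prime_mod_eight (Nat.prime_of_mem_primeFactors hp)
        (Nat.dvd_of_mem_primeFactors hp) hp2⟩
    · rintro ⟨hp, h3⟩
      refine ⟨?_, hp⟩
      rintro rfl
      omega
  · refine Finset.disjoint_filter.2 fun p _ h3 h4 => h1 (h4.symm.trans h3)

theorem IsTwoPrimeProd.erase_eq (h : IsTwoPrimeProd b) :
    b.primeFactors.erase 2 = primesMod 1 b := by
  ext p
  simp only [primesMod, Finset.mem_erase, Finset.mem_filter]
  constructor
  · rintro ⟨hp2, hp⟩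
    exact ⟨hp, (isTwoPrimeProd_iff.1 h).2.2 p (Nat.prime_of_mem_primeFactors hp)
      (Nat.dvd_of_mem_primeFactors hp) hp2⟩
  · rintro ⟨hp, h3⟩
    refine ⟨?_, hp⟩
    rintro rfl
    omega

/-- With `4 ∤ b` and `b > 2`, `b` is not a power of two. This keeps the exponent `card - 1` from
being truncated. -/
theorem IsTwoPrimeProd.primesMod_nonempty (h : IsTwoPrimeProd b) (hb : 2 < b) :
    0 < (primesMod 1 b).card := by
  rw [← h.erase_eq, Finset.card_pos]
  obtain ⟨h0, h4, -⟩ := isTwoPrimeProd_iff.1 h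
  by_cases h2 : 2 ∣ b
  · obtain ⟨c, rfl⟩ := h2
    obtain ⟨p, hp, hpc⟩ := Nat.exists_prime_and_dvd (show c ≠ 1 by omega)
    refine ⟨p, Finset.mem_erase.2 ⟨?_, Nat.mem_primeFactors.2 ⟨hp, hpc.mul_left 2, h0⟩⟩⟩
    rintro rfl
    omega
  · obtain ⟨p, hp, hpb⟩ := Nat.exists_prime_and_dvd (show b ≠ 1 by omega)
    exact ⟨p, Finset.mem_erase.2 ⟨by rintro rfl; exact h2 hpb, Nat.mem_primeFactors.2 ⟨hp, hpb, h0⟩⟩⟩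

theorem eq_two_pow_pred {N m : ℕ} (hm : 0 < m) (h : 2 * N = 2 ^ m) : N = 2 ^ (m - 1) := by
  obtain ⟨m, rfl⟩ : ∃ j, m = j + 1 := ⟨m - 1, by omega⟩
  rw [pow_succ] at h
  simp only [Nat.add_sub_cancel]
  omega

theorem IsTwoPrimeProd.ncard_properDef (h : IsTwoPrimeProd b) (hb : 2 < b) :
    (properDef b).ncard = 2 ^ ((primesMod 1 b).card - 1) := by
  obtain ⟨h0, h4, hp⟩ := isTwoPrimeProd_iff.1 h
  refine eq_two_pow_pred (h.primesMod_nonempty hb) ?_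
  rw [two_mul_ncard_properDef hb, sqrtCount_neg_two_eq h0 h4
    fun p h1 h2 h3 => Or.inl (hp p h1 h2 h3), h.erase_eq]

theorem IsDecomp.card_pos_left (h : IsDecomp {1, r} a A b) :
    0 < (primesMod 1 a).card + (primesMod r a).card := by
  refine h.card_pos.trans_le (Nat.add_le_add ?_ ?_) <;>
  · rw [h.primesMod_eq]
    exact Finset.card_le_card Finset.subset_union_left

theorem IsDecomp.ncard_properDef (h : IsDecomp {1, 3} a A b) :
    (properDef a).ncard = 2 ^ ((primesMod 1 a).card + (primesMod 3 a).card - 1) := by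
  refine eq_two_pow_pred h.card_pos_left ?_
  rw [two_mul_ncard_properDef h.two_lt_left, sqrtCount_neg_two_eq (by have := h.two_lt_left; omega)
    (h.not_four_dvd (by simp)) fun p h1 h2 h3 => h.prime_mod_eight h1 h2 h3,
    h.card_erase (by norm_num) (by norm_num)]

theorem IsDecomp.ncard_properIndef (h : IsDecomp {1, 7} a A b) :
    (properIndef a).ncard = 2 ^ ((primesMod 1 a).card + (primesMod 7 a).card - 1) := by
  refine eq_two_pow_pred h.card_pos_left ?_
  rw [two_mul_ncard_properIndef h.two_lt_left, sqrtCount_two_eq (by have := h.two_lt_left; omega)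
    (h.not_four_dvd (by simp)) fun p h1 h2 h3 => h.prime_mod_eight h1 h2 h3,
    h.card_erase (by norm_num) (by norm_num)]

theorem IsDecomp.exists_reps_three (h : IsDecomp {1, 3} a A b) :
    (∃ X Y : ℤ, IndefRep a X Y ∧ Int.gcd X Y = A ∧ 0 < X ∧ X < Y) ∧
      (∃ t k : ℤ, DefRep a t k ∧ Int.gcd t k = 1 ∧ 0 < t ∧ 0 < k) := by
  have hA : A ≠ 0 := by have := h.two_le; omega
  have hA' : (0 : ℤ) < A := by omega
  obtain ⟨h0, h4, hp⟩ := isTwoPrimeProd_iff.1 h.primes_b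
  obtain ⟨v, hv, hc, hpos, hlt⟩ :=
    exists_properIndef h.two_lt h4 fun p h1 h2 h3 => Or.inl (hp p h1 h2 h3)
  obtain ⟨w, hw, hc', ht, hk⟩ := exists_properDef h.two_lt_left (h.not_four_dvd (by simp))
    fun p h1 h2 h3 => h.prime_mod_eight h1 h2 h3
  obtain ⟨h1, h2⟩ := (indefRep_gcd_iff hA _ _).2 ⟨v.1, v.2, rfl, rfl, hv, hc⟩
  rw [← h.eq] at h1
  exact ⟨⟨_, _, h1, h2, mul_pos hA' hpos, mul_lt_mul_of_pos_left hlt hA'⟩,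
    ⟨_, _, hw, hc', ht, hk⟩⟩

theorem IsDecomp.exists_reps_seven (h : IsDecomp {1, 7} a A b) :
    (∃ X Y : ℤ, IndefRep a X Y ∧ Int.gcd X Y = 1 ∧ 0 < X ∧ X < Y) ∧
      (∃ t k : ℤ, DefRep a t k ∧ Int.gcd t k = A ∧ 0 < t ∧ 0 < k) := by
  have hA : A ≠ 0 := by have := h.two_le; omega
  have hA' : (0 : ℤ) < A := by omega
  obtain ⟨h0, h4, hp⟩ := isTwoPrimeProd_iff.1 h.primes_b
  obtain ⟨v, hv, hc, ht, hk⟩ :=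
    exists_properDef h.two_lt h4 fun p h1 h2 h3 => Or.inl (hp p h1 h2 h3)
  obtain ⟨w, hw, hc', hpos, hlt⟩ := exists_properIndef h.two_lt_left (h.not_four_dvd (by simp))
    fun p h1 h2 h3 => h.prime_mod_eight h1 h2 h3
  obtain ⟨h1, h2⟩ := (defRep_gcd_iff hA _ _).2 ⟨v.1, v.2, rfl, rfl, hv, hc⟩
  rw [← h.eq] at h1
  exact ⟨⟨_, _, hw, hc', hpos, hlt⟩, ⟨_, _, h1, h2, mul_pos hA' ht, mul_pos hA' hk⟩⟩

end Decomp

/-! ### Arithmetic of primitive triples -/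

section Triple

variable {c₁ c₂ c₃ q X Y t k : ℤ}

/-- Because `q ^ 2 > c₃ * (c₁ + c₂) > q * (c₁ + c₂)`. -/
theorem TripleData.sum_lt (h : TripleData c₁ c₂ c₃ q X Y t k) : c₁ + c₂ < q := by
  obtain ⟨h1, h2, h3, -, h5, h6, h7, rfl, rfl, rfl, rfl⟩ := h
  by_contra! hq
  have h8 : 0 < c₁ * c₂ := mul_pos h1 (h1.trans h2)
  have h9 : q * (c₁ + c₂) < c₃ * (c₁ + c₂) := mul_lt_mul_of_pos_right h7 (by linarith)
  nlinarith

theorem TripleData.t_sq (h : TripleData c₁ c₂ c₃ q X Y t k) :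
    t ^ 2 = (c₁ + c₂) ^ 2 + 4 * (c₁ * c₂) + 4 * k * (c₁ + c₂) := by
  rw [h.t_eq, h.k_eq]
  linear_combination 4 * h.q_sq

theorem TripleData.k_pos (h : TripleData c₁ c₂ c₃ q X Y t k) : 0 < k := by
  have := h.k_eq
  have := h.q_lt
  omega

theorem TripleData.sum_lt_t (h : TripleData c₁ c₂ c₃ q X Y t k) : c₁ + c₂ < t := by
  have := h.t_eq
  have := h.sum_lt
  omega

theorem TripleData.form_eq (h : TripleData c₁ c₂ c₃ q X Y t k) :
    X ^ 2 - 2 * Y ^ 2 = -(t ^ 2 + 2 * k ^ 2) := by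
  rw [h.t_sq, h.X_eq, h.Y_eq]
  ring

theorem TripleData.lt (h : TripleData c₁ c₂ c₃ q X Y t k) : X < Y - k := by
  have := h.X_eq
  have := h.Y_eq
  have := h.pos
  omega

theorem TripleData.qualifies (h : TripleData c₁ c₂ c₃ q X Y t k) {a : ℕ} (ha : DefRep a t k) :
    Qualifies a X Y t k where
  indef := by
    unfold IndefRep
    rw [h.form_eq, ← ha]
  defin := ha
  X_pos := by
    have := h.X_eq
    have := h.lt₁₂
    omega
  X_lt := by
    have := h.lt
    have := h.k_pos
    omega
  t_pos := by
    have := h.sum_lt_t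
    have := h.pos
    have := h.lt₁₂
    omega
  k_pos := h.k_pos

theorem IsFinal.qualifies (h : IsFinal X Y t k) {a : ℕ} (ha : DefRep a t k) :
    Qualifies a X Y t k := by
  obtain ⟨c₁, c₂, c₃, q, h⟩ := h
  exact h.qualifies ha

theorem IsFinal.exists_qualifies (h : IsFinal X Y t k) :
    ∃ a : ℕ, 2 < a ∧ Qualifies a X Y t k ∧ X < Y - k := by
  obtain ⟨c₁, c₂, c₃, q, h⟩ := h
  have ha : DefRep (t ^ 2 + 2 * k ^ 2).toNat t k := (Int.toNat_of_nonneg (by positivity)).symm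
  have hq := h.qualifies ha
  refine ⟨_, ?_, hq, h.lt⟩
  have h1 := hq.t_pos
  have h2 := hq.k_pos
  have : 2 < t ^ 2 + 2 * k ^ 2 := by nlinarith
  omega

theorem TripleData.not_dvd (h : TripleData c₁ c₂ c₃ q X Y t k) {p : ℤ} (hp : ¬ IsUnit p) :
    ¬ (p ∣ c₁ ∧ p ∣ c₂ ∧ p ∣ c₃) := by
  rintro ⟨h1, h2, h3⟩
  have := Int.dvd_coe_gcd (Int.dvd_coe_gcd h1 h2) h3
  rw [h.primitive] at this
  exact hp (isUnit_of_dvd_one this)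

/-- Here `c₁` and `c₂` have equal parity. If even, all entries are even, against primitivity. If
odd, `q` is odd, and `c₁ * c₂ + c₃ * (c₁ + c₂)` is `3` modulo `4`, not a square. -/
theorem TripleData.not_even (h : TripleData c₁ c₂ c₃ q X Y t k) (hX : 2 ∣ X) (hY : 2 ∣ Y)
    (hk : 2 ∣ k) : False := by
  obtain ⟨x, hx⟩ := hX
  obtain ⟨y, hy⟩ := hY
  obtain ⟨l, hl⟩ := hk
  have hXe := h.X_eq
  have hYe := h.Y_eq
  have hke := h.k_eq
  have hq := h.q_sq
  rcases Int.even_or_odd' c₁ with ⟨m, hm | hm⟩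
  · have h2 : (2 : ℤ) ∣ c₂ := by omega
    obtain ⟨j, hj⟩ := h2
    have hq2 : (2 : ℤ) ∣ q := Int.prime_two.dvd_of_dvd_pow (n := 2)
      ⟨m * c₂ + m * c₃ + j * c₃, by rw [hq, hm, hj]; ring⟩
    exact h.not_dvd (p := 2) Int.prime_two.not_isUnit ⟨⟨m, hm⟩, ⟨j, hj⟩, by omega⟩
  · have hc₂ : c₂ = 2 * (m + x) + 1 := by omega
    have hc₃ : c₃ = q + 2 * l := by omega
    rw [hm, hc₂, hc₃] at hq
    rcases Int.even_or_odd' q with ⟨j, hj | hj⟩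
    · rw [hj] at hq
      ring_nf at hq
      omega
    · rw [hj] at hq
      rcases Int.even_or_odd' x with ⟨i, hi | hi⟩
      · have : 4 * (j ^ 2 + j) + 1 = 4 * (m ^ 2 + m * (2 * i) + m + i) + 1 +
            4 * (2 * j * m + 2 * j * i + j + l * (2 * m + 2 * i + 1) + m + i) + 2 := by
          rw [hi] at hq
          linear_combination hq
        omega
      · have : 4 * (j ^ 2 + j) + 1 = 4 * (m ^ 2 + m * (2 * i + 1) + m + i) + 3 +
            4 * (j * (2 * m + 2 * i + 2) + l * (2 * m + 2 * i + 2) + m + i + 1) := by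
          rw [hi] at hq
          linear_combination hq
        omega

theorem IsFinal.coprime_gcd (h : IsFinal X Y t k) :
    Nat.Coprime (Int.gcd X Y) (Int.gcd t k) := by
  obtain ⟨c₁, c₂, c₃, q, h⟩ := h
  refine Nat.coprime_of_dvd fun p hp h1 h2 => ?_
  have hpp := Nat.prime_iff_prime_int.1 hp
  have hX := (Int.natCast_dvd_natCast.2 h1).trans (Int.gcd_dvd_left X Y)
  have hY := (Int.natCast_dvd_natCast.2 h1).trans (Int.gcd_dvd_right X Y)
  have ht := (Int.natCast_dvd_natCast.2 h2).trans (Int.gcd_dvd_left t k)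
  have hk := (Int.natCast_dvd_natCast.2 h2).trans (Int.gcd_dvd_right t k)
  by_cases hp2 : p = 2
  · subst hp2
    exact h.not_even hX hY hk
  · have hodd : ∀ x : ℤ, (p : ℤ) ∣ 2 * x → (p : ℤ) ∣ x := fun x hx =>
      (hpp.dvd_or_dvd hx).resolve_left (not_dvd_two hp hp2)
    have hc₂ : (p : ℤ) ∣ c₂ := hodd _ (by
      have := (hY.sub hk).add hX
      rwa [show Y - k + X = 2 * c₂ by rw [h.Y_eq, h.X_eq]; ring] at this)
    have hc₁ : (p : ℤ) ∣ c₁ := by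
      have := hc₂.sub hX
      rwa [show c₂ - X = c₁ by rw [h.X_eq]; ring] at this
    have hq : (p : ℤ) ∣ q := hodd _ (by
      have := ht.add (hc₁.add hc₂)
      rwa [show t + (c₁ + c₂) = 2 * q by rw [h.t_eq]; ring] at this)
    have hc₃ : (p : ℤ) ∣ c₃ := by
      have := hk.add hq
      rwa [show k + q = c₃ by rw [h.k_eq]; ring] at this
    exact h.not_dvd hpp.not_isUnit ⟨hc₁, hc₂, hc₃⟩

theorem IsFinal.le_of_defRep (h : IsFinal X Y t k) {a : ℕ} (ha : DefRep a t k) : 89 ≤ a := by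
  obtain ⟨c₁, c₂, c₃, q, h⟩ := h
  have hk := h.k_pos
  have hs := h.sum_lt_t
  have ht := h.t_sq
  have h1 := h.pos
  have h2 := h.lt₁₂
  unfold DefRep at ha
  by_contra! hlt
  have hlt' : (a : ℤ) < 89 := by exact_mod_cast hlt
  have ht9 : t ≤ 9 := by nlinarith
  have hk6 : k ≤ 6 := by nlinarith
  have hc₁ : c₁ ≤ 3 := by omega
  have hc₂ : c₂ ≤ 7 := by omega
  -- The box comes from `t ^ 2 + 2 * k ^ 2 < 89` together with `c₁ < c₂` and `c₁ + c₂ < t`.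
  have key : ∀ c₁ ∈ Finset.Icc (1 : ℤ) 3, ∀ c₂ ∈ Finset.Icc (2 : ℤ) 7, ∀ k ∈ Finset.Icc (1 : ℤ) 6,
      ∀ t ∈ Finset.Icc (1 : ℤ) 9, c₁ < c₂ →
      t ^ 2 = (c₁ + c₂) ^ 2 + 4 * (c₁ * c₂) + 4 * k * (c₁ + c₂) → 89 ≤ t ^ 2 + 2 * k ^ 2 := by
    decide +kernel
  have := key c₁ (Finset.mem_Icc.2 ⟨by omega, hc₁⟩) c₂ (Finset.mem_Icc.2 ⟨by omega, hc₂⟩)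
    k (Finset.mem_Icc.2 ⟨by omega, hk6⟩) t (Finset.mem_Icc.2 ⟨by omega, ht9⟩) h2 ht
  omega

end Triple

/-! ### Smallest values for the three types -/

theorem IsTwoPrimeProd.exists_prime {b : ℕ} (h : IsTwoPrimeProd b) (hb : 2 < b) :
    ∃ p : ℕ, p.Prime ∧ p ∣ b ∧ p % 8 = 1 ∧ 17 ≤ p := by
  obtain ⟨p, hp⟩ := Finset.card_pos.1 (h.primesMod_nonempty hb)
  obtain ⟨hp, h8⟩ := Finset.mem_filter.1 hp
  have hp' := Nat.prime_of_mem_primeFactors hp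
  refine ⟨p, hp', Nat.dvd_of_mem_primeFactors hp, h8, ?_⟩
  by_contra! hlt
  obtain rfl | rfl : p = 1 ∨ p = 9 := by omega
  · exact Nat.not_prime_one hp'
  · norm_num at hp'

theorem IsTwoPrimeProd.le {b : ℕ} (h : IsTwoPrimeProd b) (hb : 2 < b) : 17 ≤ b := by
  obtain ⟨p, -, hpb, -, hp⟩ := h.exists_prime hb
  exact hp.trans (Nat.le_of_dvd (by omega) hpb)

theorem IsTwoPrimeProd.eq_of_lt {b : ℕ} (h : IsTwoPrimeProd b) (hb : 2 < b) (hb' : b < 34) :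
    b = 17 := by
  obtain ⟨p, hp, ⟨c, rfl⟩, h8, h17⟩ := h.exists_prime hb
  have hc : c = 1 := by
    have : c ≠ 0 := by rintro rfl; simp at hb
    have : c < 2 := by nlinarith
    omega
  rw [hc, mul_one] at hb' ⊢
  obtain rfl | rfl | rfl : p = 17 ∨ p = 25 ∨ p = 33 := by omega
  · rfl
  · norm_num at hp
  · norm_num at hp

theorem IsDecomp.le_of_three {a A b : ℕ} (h : IsDecomp {1, 3} a A b) : 153 ≤ a := by
  have hb := h.primes_b.le h.two_lt
  have hA : 3 ≤ A := by
    have h1 := h.two_le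
    have h2 := h.primes_A.odd (by simp)
    omega
  rw [h.eq]
  nlinarith

/-- From `b ≥ 17` follows `A < 10`, and `A` is prime to `2, 3, 5`; so the only candidate below `1666
= 7 ^ 2 * 34` is `833 = 7 ^ 2 * 17`. -/
theorem IsDecomp.eq_of_seven {a A b : ℕ} (h : IsDecomp {1, 7} a A b) (ha : a < 1666) :
    A = 7 ∧ b = 17 := by
  have hb := h.primes_b.le h.two_lt
  have hA : A = 7 := by
    have h1 := h.two_le
    have h2 : ∀ p : ℕ, p.Prime → p % 8 ≠ 1 → p % 8 ≠ 7 → ¬ p ∣ A := fun p hp h3 h4 hpA => by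
      have := (isPrimeProd_iff.1 h.primes_A).2 p hp hpA
      simp [h3, h4] at this
    have h3 := h2 2 Nat.prime_two (by norm_num) (by norm_num)
    have h4 := h2 3 Nat.prime_three (by norm_num) (by norm_num)
    have h5 := h2 5 Nat.prime_five (by norm_num) (by norm_num)
    have h6 : A < 10 := by
      by_contra! h6
      rw [h.eq] at ha
      nlinarith
    interval_cases A <;> omega
  refine ⟨hA, h.primes_b.eq_of_lt h.two_lt ?_⟩
  rw [h.eq, hA] at ha
  omega

theorem Qualifies.classify {a : ℕ} {X Y t k : ℤ} (h : Qualifies a X Y t k)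
    (ha : 2 ≤ a) (hn : ¬ (Int.gcd X Y ≠ 1 ∧ Int.gcd t k ≠ 1)) :
    (Int.gcd X Y = 1 ∧ Int.gcd t k = 1 ∧ IsTwoPrimeProd a) ∨
      (Int.gcd X Y ≠ 1 ∧ Int.gcd t k = 1 ∧ ∃ b : ℕ, IsDecomp {1, 3} a (Int.gcd X Y) b) ∨
      (Int.gcd X Y = 1 ∧ Int.gcd t k ≠ 1 ∧ ∃ b : ℕ, IsDecomp {1, 7} a (Int.gcd t k) b) := by
  by_cases h1 : Int.gcd X Y = 1
  · by_cases h2 : Int.gcd t k = 1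
    · exact Or.inl ⟨h1, h2, isTwoPrimeProd_of_reps (by omega) h.indef
        (Int.isCoprime_iff_gcd_eq_one.2 h1) h.defin (Int.isCoprime_iff_gcd_eq_one.2 h2)⟩
    · have h3 : 0 < Int.gcd t k := Int.gcd_pos_of_ne_zero_left _ h.t_pos.ne'
      exact Or.inr (Or.inr ⟨h1, h2, isDecomp_of_improper_def (by omega) h.defin rfl h.t_pos h.k_pos
        h.indef (Int.isCoprime_iff_gcd_eq_one.2 h1)⟩)
  · have h2 : Int.gcd t k = 1 := by tauto
    have h3 : 0 < Int.gcd X Y := Int.gcd_pos_of_ne_zero_left _ h.X_pos.ne'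
    exact Or.inr (Or.inl ⟨h1, h2, isDecomp_of_improper_indef (by omega) h.indef rfl h.X_pos h.X_lt
      h.defin (Int.isCoprime_iff_gcd_eq_one.2 h2)⟩)

theorem IsFinal.le_of_improper_indef {a : ℕ} {X Y t k : ℤ} (h : IsFinal X Y t k)
    (ha : DefRep a t k) (hXY : Int.gcd X Y ≠ 1) (htk : Int.gcd t k = 1) : 153 ≤ a := by
  rcases (h.qualifies ha).classify (by have := h.le_of_defRep ha; omega) (by tauto) with
    h1 | h1 | h1
  · exact absurd h1.1 hXY
  · obtain ⟨-, -, b, hb⟩ := h1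
    exact hb.le_of_three
  · exact absurd h1.1 hXY

theorem IsFinal.le_of_improper_def {a : ℕ} {X Y t k : ℤ} (h : IsFinal X Y t k)
    (ha : DefRep a t k) (hXY : Int.gcd X Y = 1) (htk : Int.gcd t k ≠ 1) : 1666 ≤ a := by
  have hq := h.qualifies ha
  rcases hq.classify (by have := h.le_of_defRep ha; omega) (by tauto) with h1 | h1 | h1
  · exact absurd h1.2.1 htk
  · exact absurd h1.2.1 htk
  · obtain ⟨-, -, b, hb⟩ := h1
    by_contra! hlt
    obtain ⟨hA, rfl⟩ := hb.eq_of_seven hlt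
    obtain ⟨x, y, hx, hy, hxy, -⟩ := (defRep_gcd_iff (A := 7) (b := 17) (by norm_num) t k).1
      ⟨by have := hb.eq; rwa [this, hA] at ha, hA⟩
    have hx0 := hq.t_pos
    have hy0 := hq.k_pos
    push_cast at hx hy
    unfold DefRep at hxy
    push_cast at hxy
    have hx4 : x ≤ 4 := by nlinarith
    have hy2 : y ≤ 2 := by nlinarith
    have hx1 : 1 ≤ x := by omega
    have hy1 : 1 ≤ y := by omega
    -- `17 = 3 ^ 2 + 2 * 2 ^ 2` is the only positive representation, so `t = 21` and `k = 14`; no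
    -- `c₁ < c₂` satisfy the identity for `t ^ 2`, hence `833` is not attained by a triple.
    obtain ⟨rfl, rfl⟩ : x = 3 ∧ y = 2 := by
      interval_cases x <;> interval_cases y <;> simp_all
    obtain ⟨c₁, c₂, c₃, q, h⟩ := h
    have ht := h.t_sq
    have h1 := h.pos
    have h2 := h.lt₁₂
    rw [hx, hy] at ht
    have hs : c₁ + c₂ ≤ 6 := by nlinarith
    have hc₁ : c₁ ≤ 2 := by omega
    have hc₂ : c₂ ≤ 5 := by omega
    interval_cases c₁ <;> interval_cases c₂ <;> omega

theorem proposition8 :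
    -- Every primitive triple with q < c₃ yields a qualifying simultaneous representation.
    (∀ X Y t k : ℤ, IsFinal X Y t k →
      ∃ a : ℕ, 2 < a ∧ Qualifies a X Y t k ∧ X < Y - k) ∧
    -- A common factor of both representations is impossible for primitive triples.
    (∀ X Y t k : ℤ, IsFinal X Y t k → Nat.Coprime (Int.gcd X Y) (Int.gcd t k)) ∧
    -- The three types of qualifying solutions, if not both representations are improper.
    (∀ (a : ℕ) (X Y t k : ℤ), 2 ≤ a → Qualifies a X Y t k →
      ¬ (Int.gcd X Y ≠ 1 ∧ Int.gcd t k ≠ 1) →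
      (Int.gcd X Y = 1 ∧ Int.gcd t k = 1 ∧ IsTwoPrimeProd a) ∨
      (Int.gcd X Y ≠ 1 ∧ Int.gcd t k = 1 ∧ ∃ b : ℕ, IsDecomp {1, 3} a (Int.gcd X Y) b) ∨
      (Int.gcd X Y = 1 ∧ Int.gcd t k ≠ 1 ∧ ∃ b : ℕ, IsDecomp {1, 7} a (Int.gcd t k) b)) ∧
    -- Type a)
    (∀ a : ℕ, 2 ≤ a →
      (((∃ X Y : ℤ, IndefRep a X Y ∧ Int.gcd X Y = 1) ∧
        (∃ t k : ℤ, DefRep a t k ∧ Int.gcd t k = 1)) ↔ IsTwoPrimeProd a)) ∧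
    (∀ a : ℕ, 2 < a → IsTwoPrimeProd a → OnePerConjugatePair a) ∧
    -- Type b)
    (∀ a A : ℕ, 2 ≤ a → 2 ≤ A →
      (((∃ X Y : ℤ, IndefRep a X Y ∧ Int.gcd X Y = A ∧ 0 < X ∧ X < Y) ∧
        (∃ t k : ℤ, DefRep a t k ∧ Int.gcd t k = 1 ∧ 0 < t ∧ 0 < k)) ↔
        ∃ b : ℕ, IsDecomp {1, 3} a A b)) ∧
    (∀ a A b : ℕ, IsDecomp {1, 3} a A b →
      primesMod 1 a = primesMod 1 A ∪ primesMod 1 b ∧ primesMod 3 a = primesMod 3 A ∧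
      0 < (primesMod 1 A).card + (primesMod 3 A).card ∧
      (∀ X Y : ℤ, (IndefRep a X Y ∧ Int.gcd X Y = A) ↔
        ∃ X' Y' : ℤ, X = A * X' ∧ Y = A * Y' ∧ IndefRep b X' Y' ∧ Int.gcd X' Y' = 1) ∧
      OnePerConjugatePair b ∧
      (properDef a).ncard = 2 ^ ((primesMod 1 a).card + (primesMod 3 a).card - 1)) ∧
    -- Type c)
    (∀ a A : ℕ, 2 ≤ a → 2 ≤ A →
      (((∃ X Y : ℤ, IndefRep a X Y ∧ Int.gcd X Y = 1 ∧ 0 < X ∧ X < Y) ∧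
        (∃ t k : ℤ, DefRep a t k ∧ Int.gcd t k = A ∧ 0 < t ∧ 0 < k)) ↔
        ∃ b : ℕ, IsDecomp {1, 7} a A b)) ∧
    (∀ a A b : ℕ, IsDecomp {1, 7} a A b →
      primesMod 1 a = primesMod 1 A ∪ primesMod 1 b ∧ primesMod 7 a = primesMod 7 A ∧
      0 < (primesMod 1 A).card + (primesMod 7 A).card ∧
      (∀ t k : ℤ, (DefRep a t k ∧ Int.gcd t k = A) ↔
        ∃ t' k' : ℤ, t = A * t' ∧ k = A * k' ∧ DefRep b t' k' ∧ Int.gcd t' k' = 1) ∧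
      (properDef b).ncard = 2 ^ ((primesMod 1 b).card - 1) ∧
      OnePerConjugatePair a ∧
      (properIndef a).ncard = 2 ^ ((primesMod 1 a).card + (primesMod 7 a).card - 1)) ∧
    -- The first instances of final solutions of the three types, and triples that realize them.
    (IsLeast {a : ℕ | ∃ X Y t k : ℤ, IsFinal X Y t k ∧ DefRep a t k ∧
        Int.gcd X Y = 1 ∧ Int.gcd t k = 1} 89 ∧ TripleData 1 4 9 7 3 7 9 2) ∧
    (IsLeast {a : ℕ | ∃ X Y t k : ℤ, IsFinal X Y t k ∧ DefRep a t k ∧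
        Int.gcd X Y ≠ 1 ∧ Int.gcd t k = 1} 153 ∧ TripleData 1 4 12 8 3 9 11 4) ∧
    (IsLeast {a : ℕ | ∃ X Y t k : ℤ, IsFinal X Y t k ∧ DefRep a t k ∧
        Int.gcd X Y = 1 ∧ Int.gcd t k ≠ 1} 1666 ∧ TripleData 2 6 39 18 4 29 28 21) := by
  refine ⟨fun X Y t k h => h.exists_qualifies, fun X Y t k h => h.coprime_gcd,
    fun a X Y t k ha h hn => h.classify ha hn, fun a ha => ⟨?_, fun h => h.exists_reps ha⟩,
    fun a ha _ => onePerConjugatePair ha, fun a A ha hA => ⟨?_, ?_⟩, fun a A b h => ?_,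
    fun a A ha hA => ⟨?_, ?_⟩, fun a A b h => ?_, ?_, ?_, ?_⟩
  · rintro ⟨⟨X, Y, h, hXY⟩, ⟨t, k, h', htk⟩⟩
    exact isTwoPrimeProd_of_reps (by omega) h (Int.isCoprime_iff_gcd_eq_one.2 hXY) h'
      (Int.isCoprime_iff_gcd_eq_one.2 htk)
  · rintro ⟨⟨X, Y, h, hg, hX, hXY⟩, ⟨t, k, h', htk, -, -⟩⟩
    exact isDecomp_of_improper_indef hA h hg hX hXY h' (Int.isCoprime_iff_gcd_eq_one.2 htk)
  · rintro ⟨b, h⟩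
    exact h.exists_reps_three
  · have hA : A ≠ 0 := by have := h.two_le; omega
    refine ⟨h.primesMod_eq 1, ?_, h.card_pos, ?_, onePerConjugatePair h.two_lt, h.ncard_properDef⟩
    · rw [h.primesMod_eq, h.primes_b.primesMod_eq_empty (by norm_num) (by norm_num),
        Finset.union_empty]
    · rw [h.eq]
      exact indefRep_gcd_iff hA
  · rintro ⟨⟨X, Y, h, hXY, -, -⟩, ⟨t, k, h', hg, ht, hk⟩⟩
    exact isDecomp_of_improper_def hA h' hg ht hk h (Int.isCoprime_iff_gcd_eq_one.2 hXY)
  · rintro ⟨b, h⟩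
    exact h.exists_reps_seven
  · have hA : A ≠ 0 := by have := h.two_le; omega
    refine ⟨h.primesMod_eq 1, ?_, h.card_pos, ?_, h.primes_b.ncard_properDef h.two_lt,
      onePerConjugatePair h.two_lt_left, h.ncard_properIndef⟩
    · rw [h.primesMod_eq, h.primes_b.primesMod_eq_empty (by norm_num) (by norm_num),
        Finset.union_empty]
    · rw [h.eq]
      exact defRep_gcd_iff hA
  · have h : TripleData 1 4 9 7 3 7 9 2 := by constructor <;> norm_num
    refine ⟨⟨⟨_, _, _, _, ⟨_, _, _, _, h⟩, by norm_num [DefRep], by norm_num, by norm_num⟩, ?_⟩, h⟩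
    rintro a ⟨X, Y, t, k, hf, ha, -, -⟩
    exact hf.le_of_defRep ha
  · have h : TripleData 1 4 12 8 3 9 11 4 := by constructor <;> norm_num
    refine ⟨⟨⟨_, _, _, _, ⟨_, _, _, _, h⟩, by norm_num [DefRep], by norm_num, by norm_num⟩, ?_⟩, h⟩
    rintro a ⟨X, Y, t, k, hf, ha, hXY, htk⟩
    exact hf.le_of_improper_indef ha hXY htk
  · have h : TripleData 2 6 39 18 4 29 28 21 := by constructor <;> norm_num
    refine ⟨⟨⟨_, _, _, _, ⟨_, _, _, _, h⟩, by norm_num [DefRep], by norm_num, by norm_num⟩, ?_⟩, h⟩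
    rintro a ⟨X, Y, t, k, hf, ha, hXY, htk⟩
    exact hf.le_of_improper_def ha hXY htk
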